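/- Theorem. There are a deterministic random access machine program $P$ and a constant $c$ such that for every $n \ge 0$ and every simple undirected graph $G$ with vertex set $\{0,\dots,n-1\}$, given as $n$ and its adjacency matrix, the program $P$ halts and outputs every minimal connected vertex cover of $G$ exactly once and nothing else, and, if $n \ge 2$, the total number of steps, from the start to the halt, is at most $$(n + |\mathcal S_{\rm cvc}|)^{c \log n}.$$ In short: the minimal connected vertex covers of an $n$-vertex graph can be enumerated in total time $(n+|\mathcal S_{\rm cvc}|)^{O(\log n)}$. Here a vertex set $C$ is a connected vertex cover of $G$ if every edge of $G$ has at least one end vertex in $C$ and the induced subgraph $G[C]$ is connected (a connected graph has at least one vertex), and $\mathcal S_{\rm cvc}$ is the collection of all inclusion-wise minimal connected vertex covers of $G$. The machine works on natural numbers with indirect addressing; constants, addition, truncated subtraction, loading, storing, writing one number to the output, and each test of a number for zero cost one step each. A set is output as the list of its elements $v$, each written as the number $v+1$, in increasing order, followed by an end mark $0$. -/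

import Mathlib

/-- `C` is a connected vertex cover of `G`: every edge of `G` has an endpoint in `C`, and the
subgraph of `G` induced by `C` is connected (in particular `C` is nonempty). -/
def IsConnectedVertexCover {V : Type*} (G : SimpleGraph V) (C : Finset V) : Prop :=
  G.IsVertexCover (C : Set V) ∧ (G.induce (C : Set V)).Connected

/-- The collection of all inclusion-wise minimal connected vertex covers of `G`. -/
def minimalConnectedVertexCovers {V : Type*} (G : SimpleGraph V) : Set (Finset V) :=
  {C | Minimal (IsConnectedVertexCover G) C}

namespace RAM

/-- A configuration of a random access machine: finitely many registers are named by any given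
program, the memory is an array of cells that is addressed through registers, and the output is
a write-only tape, listed from the first symbol written to the last. All cells hold naturals. -/
structure State where
  reg : ℕ → ℕ
  mem : ℕ → ℕ
  out : List ℕ

/-- Structured programs of the random access machine. The only arithmetic is addition and
truncated subtraction, so that unit cost is polynomially related to bit cost. -/
inductive Prog : Type
  /-- `reg x := k`, for a constant `k`. -/
  | const (x k : ℕ) : Prog
  /-- `reg x := reg y + reg z`. -/
  | add (x y z : ℕ) : Prog
  /-- `reg x := reg y - reg z`, truncated at `0`. -/
  | sub (x y z : ℕ) : Prog
  /-- `reg x := mem (reg y)`. -/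
  | load (x y : ℕ) : Prog
  /-- `mem (reg x) := reg y`. -/
  | store (x y : ℕ) : Prog
  /-- Append `reg x` to the output. -/
  | write (x : ℕ) : Prog
  /-- Run the first program, then the second. -/
  | seq (p q : Prog) : Prog
  /-- If `reg x ≠ 0` run the first program, otherwise the second. -/
  | ite (x : ℕ) (p q : Prog) : Prog
  /-- As long as `reg x ≠ 0`, run the program. -/
  | loop (x : ℕ) (p : Prog) : Prog

/-- `Exec p s s' t`: started in configuration `s`, the program `p` halts in configuration `s'`
after exactly `t` steps. Every elementary instruction and every test of a conditional or of a
loop takes one step. -/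
inductive Exec : Prog → State → State → ℕ → Prop
  | const (x k : ℕ) (s : State) :
      Exec (.const x k) s { s with reg := Function.update s.reg x k } 1
  | add (x y z : ℕ) (s : State) :
      Exec (.add x y z) s { s with reg := Function.update s.reg x (s.reg y + s.reg z) } 1
  | sub (x y z : ℕ) (s : State) :
      Exec (.sub x y z) s { s with reg := Function.update s.reg x (s.reg y - s.reg z) } 1
  | load (x y : ℕ) (s : State) :
      Exec (.load x y) s { s with reg := Function.update s.reg x (s.mem (s.reg y)) } 1
  | store (x y : ℕ) (s : State) :
      Exec (.store x y) s { s with mem := Function.update s.mem (s.reg x) (s.reg y) } 1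
  | write (x : ℕ) (s : State) :
      Exec (.write x) s { s with out := s.out ++ [s.reg x] } 1
  | seq {p q : Prog} {s s' s'' : State} {t t' : ℕ} :
      Exec p s s' t → Exec q s' s'' t' → Exec (.seq p q) s s'' (t + t')
  | ite_true {x : ℕ} {p q : Prog} {s s' : State} {t : ℕ} :
      s.reg x ≠ 0 → Exec p s s' t → Exec (.ite x p q) s s' (t + 1)
  | ite_false {x : ℕ} {p q : Prog} {s s' : State} {t : ℕ} :
      s.reg x = 0 → Exec q s s' t → Exec (.ite x p q) s s' (t + 1)
  | loop_done {x : ℕ} {p : Prog} {s : State} :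
      s.reg x = 0 → Exec (.loop x p) s s 1
  | loop_step {x : ℕ} {p : Prog} {s s' s'' : State} {t t' : ℕ} :
      s.reg x ≠ 0 → Exec p s s' t → Exec (.loop x p) s' s'' t' →
      Exec (.loop x p) s s'' (t + t' + 1)

open Classical in
/-- The initial configuration on input a graph `G` with vertices `0, …, n - 1`: register `0` holds
`n`, the memory holds the adjacency matrix of `G` row by row (cell `i * n + j` is `1` if `i` and
`j` are adjacent and `0` otherwise), all other registers and cells are `0`, and the output is
empty. -/
noncomputable def graphInput {n : ℕ} (G : SimpleGraph (Fin n)) : State where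
  reg := Function.update (fun _ => 0) 0 n
  mem := fun a => if ∃ i j : Fin n, G.Adj i j ∧ a = (i : ℕ) * n + (j : ℕ) then 1 else 0
  out := []

/-- The output code of a set of vertices: the numbers `v + 1` for the elements `v` of the set,
in increasing order, followed by the end mark `0`. -/
def encodeSet {n : ℕ} (C : Finset (Fin n)) : List ℕ :=
  ((List.finRange n).filter (fun v => v ∈ C)).map (fun v => (v : ℕ) + 1) ++ [0]

/-- `Enumerates p s 𝒮 t`: started in `s`, the program `p` halts after exactly `t` steps, and
its output consists of the codes of the members of `𝒮`, each one exactly once, in some order. -/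
def Enumerates {n : ℕ} (p : Prog) (s : State) (𝒮 : Set (Finset (Fin n))) (t : ℕ) : Prop :=
  ∃ (s' : State) (l : List (Finset (Fin n))),
    Exec p s s' t ∧ l.Nodup ∧ (∀ C, C ∈ l ↔ C ∈ 𝒮) ∧ s'.out = l.flatMap encodeSet

end RAM

/-! Suppose that `G` has an edge. A dart is an ordered pair of adjacent vertices. For a vertex set
`Z`, identify at every `v ∈ Z` the darts leaving `v` with the darts entering `v`; the deficiency of
`Z` is the number of classes of darts that remain. An edge missed by `Z` leaves its two darts as
separate classes, and the darts at vertices of `Z` in different components of `G[Z]` stay apart.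
Hence the deficiency is one exactly if `Z` contains a connected vertex cover
(`defi_eq_one_of_cover`, `cover_of_defi_eq_one`), and the minimal connected vertex covers are the
minimal sets of deficiency one. Deficiency is antitone, and the drop caused by adding one vertex
shrinks as the set grows (`defi_submodular`), because a merge that joins two classes of a coarse
partition also joins two classes of a finer one.

Now let `ℋ` be the solutions found so far, and suppose that another one exists. It contains no
member of `ℋ`, so it extends to a maximal set `X` with this property, again of deficiency one; every
`y ∉ X` has some `H ∈ ℋ` with `H ⊆ X ∪ {y}`. Grow `Z ⊆ X` from the empty set, calling a vertex light
if adding it to `Z` removes less than half of the excess deficiency. If a light `y` lies outside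
`X`, add `H \ {y}`: afterwards `y` alone would remove all the excess, so by diminishing returns the
remaining excess is at most what `y` removes from `Z`, less than half. If a vertex of `X` outside
`Z` is not light, add it, and the excess halves. Otherwise `Z` together with its light vertices is
`X`. Since the initial excess is below `n²`, about `2 log₂ n` additions suffice
(`exists_candidate`).

With `b` solutions known there are only `(b + 1) n` pieces to add, so trying all short unions of
pieces costs `((b + 1) n + 1) ^ O(log n)` trials. A successful trial is shrunk greedily to a new
minimal solution; if all fail, the list is complete. Without edges the answer is the list of
singletons.

The algorithm is written in a small language of counted loops, whose translation to the machine has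
an exactly known number of steps. Since loop nesting is bounded, a bound on the loop counts bounds
the running time polynomially. -/

namespace Macro

/-! ### A language of counted loops and its step-exact translation to the machine -/

/-- Expressions over variables, eight arrays and the input memory. -/
inductive Ex : Type
  | var (x : ℕ)
  | lit (k : ℕ)
  | add (e f : Ex)
  | sub (e f : Ex)
  | get (a : Fin 8) (e : Ex)
  | inp (e : Ex)

/-- Commands; the only loops are counted loops whose bound is a variable. -/
inductive Cmd : Type
  | skip
  | set (x : ℕ) (e : Ex)
  | put (a : Fin 8) (e f : Ex)
  | wr (e : Ex)
  | seq (c d : Cmd)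
  | ite (e : Ex) (c d : Cmd)
  | rep (x y : ℕ) (c : Cmd)

/-- Configurations of the command language. -/
structure Env where
  var : ℕ → ℕ
  arr : Fin 8 → ℕ → ℕ
  out : List ℕ

/-- Assignment to a variable. -/
def Env.set (σ : Env) (x v : ℕ) : Env := { σ with var := Function.update σ.var x v }

/-- Assignment to an array cell. -/
def Env.put (σ : Env) (a : Fin 8) (i v : ℕ) : Env :=
  { σ with arr := Function.update σ.arr a (Function.update (σ.arr a) i v) }

@[simp] theorem Env.set_arr (σ : Env) (x v : ℕ) : (σ.set x v).arr = σ.arr := rfl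
@[simp] theorem Env.set_out (σ : Env) (x v : ℕ) : (σ.set x v).out = σ.out := rfl
@[simp] theorem Env.put_var (σ : Env) (a i v) : (σ.put a i v).var = σ.var := rfl
@[simp] theorem Env.put_out (σ : Env) (a i v) : (σ.put a i v).out = σ.out := rfl
theorem Env.set_var (σ : Env) (x v z : ℕ) :
    (σ.set x v).var z = if z = x then v else σ.var z := by
  simp [Env.set, Function.update_apply]
theorem Env.put_arr (σ : Env) (a : Fin 8) (i v : ℕ) (a' : Fin 8) (j : ℕ) :
    (σ.put a i v).arr a' j = if a' = a ∧ j = i then v else σ.arr a' j := by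
  simp only [Env.put, Function.update_apply]
  by_cases h : a' = a
  · subst h; by_cases h' : j = i <;> simp [h']
  · simp [h]

variable (B : ℕ) (inp : ℕ → ℕ)

/-- The value of an expression. The memory cells from `B` on hold the interleaved arrays. -/
def Ex.eval : Ex → Env → ℕ
  | .var x, σ => σ.var x
  | .lit k, _ => k
  | .add e f, σ => e.eval σ + f.eval σ
  | .sub e f, σ => e.eval σ - f.eval σ
  | .get a e, σ => σ.arr a (e.eval σ)
  | .inp e, σ => if e.eval σ < B then inp (e.eval σ) else
      σ.arr (Fin.ofNat 8 (e.eval σ - B)) ((e.eval σ - B) / 8)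

/-- The state of a counted loop after `i` rounds. -/
def iterFor (f : Env → Env) (x : ℕ) : ℕ → Env → Env
  | 0, σ => σ
  | i + 1, σ => f ((iterFor f x i σ).set x i)

/-- The effect of a command. -/
def Cmd.run : Cmd → Env → Env
  | .skip, σ => σ
  | .set x e, σ => σ.set x (e.eval B inp σ)
  | .put a e f, σ => σ.put a (e.eval B inp σ) (f.eval B inp σ)
  | .wr e, σ => { σ with out := σ.out ++ [e.eval B inp σ] }
  | .seq c d, σ => d.run (c.run σ)
  | .ite e c d, σ => if e.eval B inp σ ≠ 0 then c.run σ else d.run σ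
  | .rep x y c, σ => iterFor c.run x (σ.var y) σ

/-- The number of machine steps of the compiled expression. -/
def Ex.cost : Ex → ℕ
  | .var _ => 2
  | .lit _ => 1
  | .add e f => e.cost + (f.cost + 1)
  | .sub e f => e.cost + (f.cost + 1)
  | .get _ e => e.cost + 7
  | .inp e => e.cost + 1

/-- The number of machine steps of the compiled command. -/
def Cmd.time : Cmd → Env → ℕ
  | .skip, _ => 1
  | .set _ e, _ => e.cost + 2
  | .put _ e f, _ => e.cost + f.cost + 7
  | .wr e, _ => e.cost + 1
  | .seq c d, σ => c.time σ + d.time (c.run B inp σ)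
  | .ite e c d, σ => e.cost + ((if e.eval B inp σ ≠ 0 then c.time σ else d.time σ) + 1)
  | .rep x y c, σ =>
      (∑ i ∈ Finset.range (σ.var y), (c.time ((iterFor (c.run B inp) x i σ).set x i) + 6)) + 4

open RAM

/-- The `k`-th temporary register. -/
def tmp (k : ℕ) : ℕ := 2 * k + 3

/-- Machine code replacing the index in temporary `k` by the address of that cell of array `a`. -/
def addrProg (a : Fin 8) (k j : ℕ) : Prog :=
  .seq (.add (tmp k) (tmp k) (tmp k)) <| .seq (.add (tmp k) (tmp k) (tmp k)) <|
  .seq (.add (tmp k) (tmp k) (tmp k)) <| .seq (.const (tmp j) a) <|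
  .seq (.add (tmp k) (tmp k) (tmp j)) (.add (tmp k) (tmp k) 1)

/-- Machine code for an expression, with the result in temporary `k`. -/
def Ex.comp : Ex → ℕ → Prog
  | .var x, k => .seq (.const (tmp k) 0) (.add (tmp k) (tmp k) (2 * x))
  | .lit m, k => .const (tmp k) m
  | .add e f, k => .seq (e.comp k) (.seq (f.comp (k + 1)) (.add (tmp k) (tmp k) (tmp (k + 1))))
  | .sub e f, k => .seq (e.comp k) (.seq (f.comp (k + 1)) (.sub (tmp k) (tmp k) (tmp (k + 1))))
  | .get a e, k => .seq (e.comp k) (.seq (addrProg a k (k + 1)) (.load (tmp k) (tmp k)))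
  | .inp e, k => .seq (e.comp k) (.load (tmp k) (tmp k))

/-- Machine code for a command that uses only temporaries from `k` on. -/
def Cmd.comp : Cmd → ℕ → Prog
  | .skip, k => .const (tmp k) 0
  | .set x e, k => .seq (e.comp k) (.seq (.const (2 * x) 0) (.add (2 * x) (2 * x) (tmp k)))
  | .put a e f, k => .seq (e.comp k) <| .seq (f.comp (k + 1)) <|
      .seq (addrProg a k (k + 2)) (.store (tmp k) (tmp (k + 1)))
  | .wr e, k => .seq (e.comp k) (.write (tmp k))
  | .seq c d, k => .seq (c.comp k) (d.comp k)
  | .ite e c d, k => .seq (e.comp k) (.ite (tmp k) (c.comp k) (d.comp k))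
  | .rep x y c, k =>
      .seq (.const (tmp k) 0) <| .seq (.add (tmp k) (tmp k) (2 * y)) <|
      .seq (.const (tmp (k + 1)) 0) <| .loop (tmp k) <|
        .seq (.const (2 * x) 0) <| .seq (.add (2 * x) (2 * x) (tmp (k + 1))) <|
        .seq (c.comp (k + 2)) <| .seq (.const (tmp (k + 2)) 1) <|
        .seq (.add (tmp (k + 1)) (tmp (k + 1)) (tmp (k + 2)))
          (.sub (tmp k) (tmp k) (tmp (k + 2)))

/-- The machine configuration `s` represents `σ`. -/
structure Rep (s : State) (σ : Env) : Prop where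
  var : ∀ x, s.reg (2 * x) = σ.var x
  base : s.reg 1 = B
  low : ∀ a < B, s.mem a = inp a
  arr : ∀ (a : Fin 8) i, s.mem (B + 8 * i + a) = σ.arr a i
  out : s.out = σ.out

/-- The temporaries below `k` agree. -/
def Below (k : ℕ) (s s' : State) : Prop := ∀ j < k, s'.reg (tmp j) = s.reg (tmp j)

/-- Even registers are the variables, register `1` is the base address, and the odd registers from
`3` on are temporaries; code that writes only temporaries therefore preserves the represented
environment. -/
theorem Rep.congr {s s' : State} {σ : Env} (h : Rep B inp s σ) (hm : s'.mem = s.mem)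
    (ho : s'.out = s.out) (hr : ∀ r, r % 2 = 0 ∨ r = 1 → s'.reg r = s.reg r) :
    Rep B inp s' σ where
  var x := by rw [hr _ (by omega), h.var]
  base := by rw [hr _ (by omega), h.base]
  low a ha := by rw [hm, h.low a ha]
  arr a i := by rw [hm, h.arr]
  out := by rw [ho, h.out]

/-- Three doublings replace the multiplication by `8`, which the machine does not have. -/
theorem exec_addrProg (a : Fin 8) (k j : ℕ) (hkj : k < j) (s : State) :
    ∃ s', Exec (addrProg a k j) s s' 6 ∧ s'.mem = s.mem ∧ s'.out = s.out ∧
      s'.reg (tmp k) = s.reg 1 + 8 * s.reg (tmp k) + a ∧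
      ∀ r, r ≠ tmp k → r ≠ tmp j → s'.reg r = s.reg r := by
  refine ⟨_, .seq (.add ..) (.seq (.add ..) (.seq (.add ..) (.seq (.const ..) (.seq (.add ..) (.add ..))))), rfl, rfl, ?_, ?_⟩
  · have h1 : tmp k ≠ tmp j := by unfold tmp; omega
    have h2 : (1 : ℕ) ≠ tmp j := by unfold tmp; omega
    have h3 : (1 : ℕ) ≠ tmp k := by unfold tmp; omega
    simp [h1, h2, h3]
    ring
  · intro r h1 h2
    simp [Function.update_apply, h1, h2]

/-- The arrays are interleaved modulo `8` above the input and exhaust the memory there. So every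
load has a value in the source language, and the translation needs no range check. -/
theorem mem_eq {s : State} {σ : Env} (h : Rep B inp s σ) (m : ℕ) :
    s.mem m = if m < B then inp m else σ.arr (Fin.ofNat 8 (m - B)) ((m - B) / 8) := by
  split_ifs with hm
  · exact h.low m hm
  · rw [← h.arr]
    congr 1
    simp only [Fin.ofNat]
    omega

/-- The temporaries form a stack: the second operand is evaluated one level higher, so the first
result survives. -/
theorem Ex.comp_correct (e : Ex) : ∀ (k : ℕ) (s : State) (σ : Env), Rep B inp s σ →
    ∃ s', Exec (e.comp k) s s' e.cost ∧ s'.mem = s.mem ∧ s'.out = s.out ∧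
      s'.reg (tmp k) = e.eval B inp σ ∧
      ∀ r, (r % 2 = 0 ∨ r < tmp k) → s'.reg r = s.reg r := by
  induction e with
  | var x =>
    intro k s σ h
    refine ⟨_, .seq (.const ..) (.add ..), rfl, rfl, ?_, ?_⟩
    · have : 2 * x ≠ tmp k := by unfold tmp; omega
      simp [this, Ex.eval, h.var]
    · intro r hr
      have : r ≠ tmp k := by unfold tmp at *; omega
      simp [Function.update_apply, this]
  | lit m =>
    intro k s σ h
    refine ⟨_, .const .., rfl, rfl, ?_, ?_⟩
    · simp [Ex.eval]
    · intro r hr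
      have : r ≠ tmp k := by unfold tmp at *; omega
      simp [this]
  | add e f he hf =>
    intro k s σ h
    obtain ⟨s1, e1, m1, o1, v1, r1⟩ := he k s σ h
    have h1 : Rep B inp s1 σ := h.congr B inp m1 o1 fun r hr => r1 r (by unfold tmp; omega)
    obtain ⟨s2, e2, m2, o2, v2, r2⟩ := hf (k + 1) s1 σ h1
    have ex := Exec.seq e1 (.seq e2 (.add (tmp k) (tmp k) (tmp (k + 1)) s2))
    refine ⟨_, ex, by simp [m1, m2], by simp [o1, o2], ?_, ?_⟩
    · simp [Ex.eval, v2, ← v1, r2 (tmp k) (by unfold tmp; omega)]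
    · intro r hr
      have : r ≠ tmp k := by unfold tmp at *; omega
      simp only [Function.update_apply, this, if_false]
      rw [r2 r (by unfold tmp at *; omega), r1 r hr]
  | sub e f he hf =>
    intro k s σ h
    obtain ⟨s1, e1, m1, o1, v1, r1⟩ := he k s σ h
    have h1 : Rep B inp s1 σ := h.congr B inp m1 o1 fun r hr => r1 r (by unfold tmp; omega)
    obtain ⟨s2, e2, m2, o2, v2, r2⟩ := hf (k + 1) s1 σ h1
    have ex := Exec.seq e1 (.seq e2 (.sub (tmp k) (tmp k) (tmp (k + 1)) s2))
    refine ⟨_, ex, by simp [m1, m2], by simp [o1, o2], ?_, ?_⟩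
    · simp [Ex.eval, v2, ← v1, r2 (tmp k) (by unfold tmp; omega)]
    · intro r hr
      have : r ≠ tmp k := by unfold tmp at *; omega
      simp only [Function.update_apply, this, if_false]
      rw [r2 r (by unfold tmp at *; omega), r1 r hr]
  | get a e he =>
    intro k s σ h
    obtain ⟨s1, e1, m1, o1, v1, r1⟩ := he k s σ h
    have h1 : Rep B inp s1 σ := h.congr B inp m1 o1 fun r hr => r1 r (by unfold tmp; omega)
    obtain ⟨s2, e2, m2, o2, v2, r2⟩ := exec_addrProg a k (k + 1) (by omega) s1
    refine ⟨_, .seq e1 (.seq e2 (.load ..)), by simp [m1, m2], by simp [o1, o2], ?_, ?_⟩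
    · simp only [Function.update_self, Ex.eval]
      rw [v2, m2, h1.base, h1.arr, v1]
    · intro r hr
      have : r ≠ tmp k := by unfold tmp at *; omega
      have : r ≠ tmp (k + 1) := by unfold tmp at *; omega
      simp only [Function.update_apply, *, if_false]
      rw [r2 r (by assumption) (by assumption), r1 r hr]
  | inp e he =>
    intro k s σ h
    obtain ⟨s1, e1, m1, o1, v1, r1⟩ := he k s σ h
    have h1 : Rep B inp s1 σ := h.congr B inp m1 o1 fun r hr => r1 r (by unfold tmp; omega)
    refine ⟨_, .seq e1 (.load ..), by simp [m1], by simp [o1], ?_, ?_⟩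
    · simp only [Function.update_self, Ex.eval]
      rw [v1, mem_eq B inp h1]
    · intro r hr
      have : r ≠ tmp k := by unfold tmp at *; omega
      simp only [Function.update_apply, this, if_false]
      rw [r1 r hr]

/-- Temporary `k` counts the remaining rounds down and temporary `k + 1` counts the index up. The
body is compiled from level `k + 2` on, so it can disturb neither, even if it overwrites the loop
variable. The `6` steps per round are the test, two instructions before the body and three after it.
-/
theorem exec_for {x : ℕ} {c : Cmd} {k : ℕ}
    (hc : ∀ (s : State) (σ : Env), Rep B inp s σ →
      ∃ s', Exec (c.comp (k + 2)) s s' (c.time B inp σ) ∧ Rep B inp s' (c.run B inp σ) ∧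
        Below (k + 2) s s') (σ : Env) (N : ℕ) :
    ∀ (m i : ℕ) (s : State), i + m = N → Rep B inp s (iterFor (c.run B inp) x i σ) →
      s.reg (tmp k) = m → s.reg (tmp (k + 1)) = i →
      ∃ s', Exec (.loop (tmp k) <|
          .seq (.const (2 * x) 0) <| .seq (.add (2 * x) (2 * x) (tmp (k + 1))) <|
          .seq (c.comp (k + 2)) <| .seq (.const (tmp (k + 2)) 1) <|
          .seq (.add (tmp (k + 1)) (tmp (k + 1)) (tmp (k + 2)))
            (.sub (tmp k) (tmp k) (tmp (k + 2)))) s s'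
          ((∑ i ∈ Finset.Ico i N,
            (c.time B inp ((iterFor (c.run B inp) x i σ).set x i) + 6)) + 1) ∧
        Rep B inp s' (iterFor (c.run B inp) x N σ) ∧ Below k s s' := by
  intro m
  induction m with
  | zero =>
    intro i s hi h h1 h2
    obtain rfl : i = N := by omega
    exact ⟨s, by simpa using .loop_done h1, h, fun _ _ => rfl⟩
  | succ m ih =>
    intro i s hi h h1 h2
    have n1 : ∀ j z, tmp j ≠ 2 * z := by intro j z; unfold tmp; omega
    have n2 : ∀ j z, 2 * z ≠ tmp j := by intro j z; unfold tmp; omega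
    have n3 : ∀ j, (1 : ℕ) ≠ tmp j := by intro j; unfold tmp; omega
    have n4 : ∀ z, (1 : ℕ) ≠ 2 * z := by intro z; omega
    have n5 : ∀ j l, tmp j = tmp l ↔ j = l := by intro j l; unfold tmp; omega
    let s1 : State := { s with reg := Function.update s.reg (2 * x) 0 }
    let s2 : State := { s1 with reg := Function.update s1.reg (2 * x) (s1.reg (2 * x) + s1.reg (tmp (k + 1))) }
    have hs2 : Rep B inp s2 ((iterFor (c.run B inp) x i σ).set x i) := by
      refine ⟨fun z => ?_, ?_, h.low, h.arr, h.out⟩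
      · by_cases hz : z = x
        · subst hz; simp [s2, s1, Env.set, n1, h2]
        · simp [s2, s1, Env.set, hz, h.var]
      · simp [s2, s1, Function.update_apply, n4, h.base]
    obtain ⟨s3, e3, r3, b3⟩ := hc s2 _ hs2
    have hk : s3.reg (tmp k) = m + 1 := by
      rw [b3 k (by omega)]; simp [s2, s1, n1, h1]
    have hk1 : s3.reg (tmp (k + 1)) = i := by
      rw [b3 (k + 1) (by omega)]; simp [s2, s1, n1, h2]
    obtain ⟨s4, e4, m4, o4, v4, v4', r4⟩ : ∃ s4, Exec (.seq (.const (tmp (k + 2)) 1) <|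
          .seq (.add (tmp (k + 1)) (tmp (k + 1)) (tmp (k + 2)))
            (.sub (tmp k) (tmp k) (tmp (k + 2)))) s3 s4 3 ∧ s4.mem = s3.mem ∧ s4.out = s3.out ∧
          s4.reg (tmp k) = m ∧ s4.reg (tmp (k + 1)) = i + 1 ∧
          ∀ r, (r % 2 = 0 ∨ r < tmp k) → s4.reg r = s3.reg r := by
      refine ⟨_, .seq (.const ..) (.seq (.add ..) (.sub ..)), rfl, rfl, ?_, ?_, ?_⟩
      · simp [n5, hk]
      · simp [n5, hk1]
      · intro r hr
        have : r ≠ tmp k := by unfold tmp at *; omega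
        have : r ≠ tmp (k + 1) := by unfold tmp at *; omega
        have : r ≠ tmp (k + 2) := by unfold tmp at *; omega
        simp [*]
    have hr4 : Rep B inp s4 (iterFor (c.run B inp) x (i + 1) σ) :=
      r3.congr B inp m4 o4 fun r hr => r4 r (by unfold tmp; omega)
    obtain ⟨s5, e5, r5, b5⟩ := ih (i + 1) s4 (by omega) hr4 v4 v4'
    refine ⟨s5, ?_, r5, ?_⟩
    · have := Exec.loop_step (x := tmp k) (by omega)
        (Exec.seq (.const (2 * x) 0 s) (.seq (.add (2 * x) (2 * x) (tmp (k + 1)) s1) (.seq e3 e4))) e5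
      convert this using 1
      rw [Finset.sum_eq_sum_Ico_succ_bot (by omega)]
      ring
    · intro j hj
      rw [b5 j hj, r4 _ (by unfold tmp; omega), b3 j (by omega)]
      simp [s2, s1, n1]

theorem Cmd.comp_correct (c : Cmd) : ∀ (k : ℕ) (s : State) (σ : Env), Rep B inp s σ →
    ∃ s', Exec (c.comp k) s s' (c.time B inp σ) ∧ Rep B inp s' (c.run B inp σ) ∧
      Below k s s' := by
  have n1 : ∀ j z, tmp j ≠ 2 * z := by intro j z; unfold tmp; omega
  have n3 : ∀ j, (1 : ℕ) ≠ tmp j := by intro j; unfold tmp; omega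
  have n4 : ∀ z, (1 : ℕ) ≠ 2 * z := by intro z; omega
  have n5 : ∀ j l, tmp j = tmp l ↔ j = l := by intro j l; unfold tmp; omega
  induction c with
  | skip =>
    intro k s σ h
    refine ⟨_, .const .., h.congr B inp rfl rfl fun r hr => ?_, fun j hj => ?_⟩
    · have : r ≠ tmp k := by unfold tmp; omega
      simp [this]
    · have : j ≠ k := by omega
      simp [n5, this]
  | set x e =>
    intro k s σ h
    obtain ⟨s1, e1, m1, o1, v1, r1⟩ := e.comp_correct B inp k s σ h
    have h1 : Rep B inp s1 σ := h.congr B inp m1 o1 fun r hr => r1 r (by unfold tmp; omega)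
    refine ⟨_, .seq e1 (.seq (.const ..) (.add ..)),
      ⟨fun z => ?_, ?_, h1.low, h1.arr, h1.out⟩, fun j hj => ?_⟩
    · by_cases hz : z = x
      · subst hz; simp [Cmd.run, Env.set, n1, v1]
      · simp [Cmd.run, Env.set, hz, h1.var]
    · simp [Function.update_apply, n4, h1.base]
    · simp [n1]
      exact r1 _ (by unfold tmp; omega)
  | put a e f =>
    intro k s σ h
    obtain ⟨s1, e1, m1, o1, v1, r1⟩ := e.comp_correct B inp k s σ h
    have h1 : Rep B inp s1 σ := h.congr B inp m1 o1 fun r hr => r1 r (by unfold tmp; omega)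
    obtain ⟨s2, e2, m2, o2, v2, r2⟩ := f.comp_correct B inp (k + 1) s1 σ h1
    have h2 : Rep B inp s2 σ := h1.congr B inp m2 o2 fun r hr => r2 r (by unfold tmp; omega)
    obtain ⟨s3, e3, m3, o3, v3, r3⟩ := exec_addrProg a k (k + 2) (by omega) s2
    have h3 : Rep B inp s3 σ := h2.congr B inp m3 o3 fun r hr => r3 r (by unfold tmp; omega) (by unfold tmp; omega)
    have hk : s3.reg (tmp k) = B + 8 * e.eval B inp σ + a := by
      rw [v3, h2.base, r2 _ (by unfold tmp; omega), v1]
    have hv : s3.reg (tmp (k + 1)) = f.eval B inp σ := by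
      rw [r3 _ (by unfold tmp; omega) (by unfold tmp; omega), v2]
    have ex := Exec.seq e1 (.seq e2 (.seq e3 (.store (tmp k) (tmp (k + 1)) s3)))
    have et : e.cost + (f.cost + (6 + 1)) = Cmd.time B inp (.put a e f) σ := by
      simp only [Cmd.time]; omega
    rw [et] at ex
    refine ⟨_, ex, ⟨h3.var, h3.base, fun b hb => ?_, fun b i => ?_, h3.out⟩, ?_⟩
    · have : b ≠ s3.reg (tmp k) := by omega
      simp only [Function.update_apply, this, if_false]
      exact h3.low b hb
    · simp only [Cmd.run, Env.put_arr, Function.update_apply, hk, hv, h3.arr]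
      -- Both array numbers are below `8`, so quotient and remainder determine the cell.
      have : (B + 8 * i + ↑b = B + 8 * Ex.eval B inp e σ + ↑a) ↔ (b = a ∧ i = e.eval B inp σ) := by
        rw [Fin.ext_iff]; omega
      simp [this]
    · intro j hj
      simp only
      rw [r3 _ (by unfold tmp; omega) (by unfold tmp; omega), r2 _ (by unfold tmp; omega),
        r1 _ (by unfold tmp; omega)]
  | wr e =>
    intro k s σ h
    obtain ⟨s1, e1, m1, o1, v1, r1⟩ := e.comp_correct B inp k s σ h
    have h1 : Rep B inp s1 σ := h.congr B inp m1 o1 fun r hr => r1 r (by unfold tmp; omega)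
    exact ⟨_, .seq e1 (.write ..), ⟨h1.var, h1.base, h1.low, h1.arr, by simp [Cmd.run, h1.out, v1]⟩,
      fun j hj => r1 _ (by unfold tmp; omega)⟩
  | seq c d hc hd =>
    intro k s σ h
    obtain ⟨s1, e1, r1, b1⟩ := hc k s σ h
    obtain ⟨s2, e2, r2, b2⟩ := hd k s1 _ r1
    exact ⟨s2, .seq e1 e2, r2, fun j hj => by rw [b2 j hj, b1 j hj]⟩
  | ite e c d hc hd =>
    intro k s σ h
    obtain ⟨s1, e1, m1, o1, v1, r1⟩ := e.comp_correct B inp k s σ h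
    have h1 : Rep B inp s1 σ := h.congr B inp m1 o1 fun r hr => r1 r (by unfold tmp; omega)
    by_cases he : e.eval B inp σ = 0
    · obtain ⟨s2, e2, r2, b2⟩ := hd k s1 σ h1
      refine ⟨s2, ?_, by simpa [Cmd.run, he] using r2, fun j hj => by
        rw [b2 j hj, r1 _ (by unfold tmp; omega)]⟩
      simpa [Cmd.time, Cmd.comp, he] using Exec.seq e1 (.ite_false (p := c.comp k) (q := d.comp k) (by rw [v1, he]) e2)
    · obtain ⟨s2, e2, r2, b2⟩ := hc k s1 σ h1
      refine ⟨s2, ?_, by simpa [Cmd.run, he] using r2, fun j hj => by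
        rw [b2 j hj, r1 _ (by unfold tmp; omega)]⟩
      simpa [Cmd.time, Cmd.comp, he] using Exec.seq e1 (.ite_true (p := c.comp k) (q := d.comp k) (by rw [v1]; exact he) e2)
  | rep x y c hc =>
    intro k s σ h
    let s1 : State := { s with reg := Function.update s.reg (tmp k) 0 }
    let s2 : State := { s1 with reg := Function.update s1.reg (tmp k) (s1.reg (tmp k) + s1.reg (2 * y)) }
    let s3 : State := { s2 with reg := Function.update s2.reg (tmp (k + 1)) 0 }
    have hs3 : ∀ r, r ≠ tmp k → r ≠ tmp (k + 1) → s3.reg r = s.reg r := by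
      intro r h1 h2; simp [s3, s2, s1, Function.update_apply, h1, h2]
    have h3 : Rep B inp s3 σ := h.congr B inp rfl rfl fun r hr =>
      hs3 r (by unfold tmp; omega) (by unfold tmp; omega)
    obtain ⟨s4, e4, r4, b4⟩ := exec_for B inp (x := x) (k := k) (hc (k + 2)) σ (σ.var y) (σ.var y) 0 s3
      (by simp) h3 (by simp [s3, s2, s1, n5, fun z => (n1 k z).symm, h.var])
      (by simp [s3])
    refine ⟨s4, ?_, r4, fun j hj => ?_⟩
    · have := Exec.seq (.const (tmp k) 0 s) (.seq (.add (tmp k) (tmp k) (2 * y) s1) (.seq (.const (tmp (k + 1)) 0 s2) e4))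
      have et : ∀ S : ℕ, 1 + (1 + (1 + (S + 1))) = S + 4 := fun S => by omega
      rw [et, ← Finset.range_eq_Ico] at this
      exact this
    · rw [b4 j hj, hs3 _ (by unfold tmp; omega) (by unfold tmp; omega)]

end Macro

/-! ### Frame conditions, the loop rule and a time bound from loop depth -/

namespace Macro

/-- The variables that a command may change. -/
def Cmd.vars : Cmd → List ℕ
  | .skip | .put .. | .wr _ => []
  | .set x _ => [x]
  | .seq c d | .ite _ c d => c.vars ++ d.vars
  | .rep x _ c => x :: c.vars

/-- The arrays that a command may change. -/
def Cmd.arrs : Cmd → List (Fin 8)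
  | .skip | .set .. | .wr _ => []
  | .put a _ _ => [a]
  | .seq c d | .ite _ c d => c.arrs ++ d.arrs
  | .rep _ _ c => c.arrs

/-- The command contains no output instruction. -/
def Cmd.quiet : Cmd → Bool
  | .skip | .set .. | .put .. => true
  | .wr _ => false
  | .seq c d | .ite _ c d => c.quiet && d.quiet
  | .rep _ _ c => c.quiet

/-- `τ` differs from `σ` at most in what the command may change. -/
structure Frame (c : Cmd) (σ τ : Env) : Prop where
  var : ∀ z, z ∉ c.vars → τ.var z = σ.var z
  arr : ∀ a, a ∉ c.arrs → τ.arr a = σ.arr a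
  out : c.quiet = true → τ.out = σ.out

theorem iterFor_frame {f : Env → Env} {c : Cmd} (hf : ∀ σ, Frame c σ (f σ)) (x y : ℕ) (σ : Env)
    (i : ℕ) : Frame (.rep x y c) σ (iterFor f x i σ) := by
  induction i with
  | zero => exact ⟨fun _ _ => rfl, fun _ _ => rfl, fun _ => rfl⟩
  | succ i ih =>
    refine ⟨fun z hz => ?_, fun a ha => ?_, fun hq => ?_⟩
    · simp only [Cmd.vars, List.mem_cons, not_or] at hz
      rw [iterFor, (hf _).var z hz.2, Env.set_var, if_neg hz.1, ih.var z (by simp [Cmd.vars, hz])]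
    · rw [iterFor, (hf _).arr a ha, Env.set_arr, ih.arr a ha]
    · rw [iterFor, (hf _).out hq, Env.set_out, ih.out hq]

variable (B : ℕ) (inp : ℕ → ℕ)

/-- For a concrete command, preservation of a variable, of an array or of the output becomes a
decidable statement about its syntax. -/
theorem Cmd.frame (c : Cmd) : ∀ σ, Frame c σ (c.run B inp σ) := by
  induction c with
  | skip => exact fun σ => ⟨fun _ _ => rfl, fun _ _ => rfl, fun _ => rfl⟩
  | set x e =>
    exact fun σ => ⟨fun z hz => by simp_all [Cmd.run, Env.set_var, Cmd.vars],
      fun _ _ => rfl, fun _ => rfl⟩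
  | put a e f =>
    refine fun σ => ⟨fun _ _ => rfl, fun b hb => ?_, fun _ => rfl⟩
    funext i
    simp_all [Cmd.run, Env.put_arr, Cmd.arrs]
  | wr e => exact fun σ => ⟨fun _ _ => rfl, fun _ _ => rfl, fun h => by simp [Cmd.quiet] at h⟩
  | seq c d hc hd =>
    refine fun σ => ⟨fun z hz => ?_, fun b hb => ?_, fun h => ?_⟩
    · simp only [Cmd.vars, List.mem_append, not_or] at hz
      rw [Cmd.run, (hd _).var z hz.2, (hc _).var z hz.1]
    · simp only [Cmd.arrs, List.mem_append, not_or] at hb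
      rw [Cmd.run, (hd _).arr b hb.2, (hc _).arr b hb.1]
    · simp only [Cmd.quiet, Bool.and_eq_true] at h
      rw [Cmd.run, (hd _).out h.2, (hc _).out h.1]
  | ite e c d hc hd =>
    refine fun σ => ⟨fun z hz => ?_, fun b hb => ?_, fun h => ?_⟩
    · simp only [Cmd.vars, List.mem_append, not_or] at hz
      rw [Cmd.run]; split_ifs
      exacts [(hc _).var z hz.1, (hd _).var z hz.2]
    · simp only [Cmd.arrs, List.mem_append, not_or] at hb
      rw [Cmd.run]; split_ifs
      exacts [(hc _).arr b hb.1, (hd _).arr b hb.2]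
    · simp only [Cmd.quiet, Bool.and_eq_true] at h
      rw [Cmd.run]; split_ifs
      exacts [(hc _).out h.1, (hd _).out h.2]
  | rep x y c hc => exact fun σ => iterFor_frame hc x y σ _

variable {B inp}

/-- Loop rule: the frame of the loop may be used inside the invariant step. -/
theorem Cmd.for_rule {x y : ℕ} {c : Cmd} {σ : Env} (I : ℕ → Env → Prop) (h0 : I 0 σ)
    (hs : ∀ i < σ.var y, ∀ τ, Frame (.rep x y c) σ τ → τ.var x = i →
      I i τ → I (i + 1) (c.run B inp τ))
    (hI : ∀ i τ v, I i τ → I i (τ.set x v)) :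
    I (σ.var y) ((Cmd.rep x y c).run B inp σ) := by
  have key : ∀ i ≤ σ.var y, I i (iterFor (c.run B inp) x i σ) := by
    intro i
    induction i with
    | zero => exact fun _ => h0
    | succ i ih =>
      intro hi
      have hf := iterFor_frame (c.frame B inp) x y σ i
      refine hs i hi _ ⟨fun z hz => ?_, hf.arr, hf.out⟩ (by simp [Env.set_var])
        (hI _ _ _ (ih (by omega)))
      have : z ≠ x := by rintro rfl; simp [Cmd.vars] at hz
      rw [Env.set_var, if_neg this, hf.var z hz]
  exact key _ le_rfl

/-- Loop depth. -/
def Cmd.depth : Cmd → ℕ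
  | .skip | .set .. | .put .. | .wr _ => 0
  | .seq c d | .ite _ c d => max c.depth d.depth
  | .rep _ _ c => c.depth + 1

/-- A weighted count of instructions. -/
def Cmd.size : Cmd → ℕ
  | .skip => 1
  | .set _ e => e.cost + 2
  | .put _ e f => e.cost + f.cost + 7
  | .wr e => e.cost + 1
  | .seq c d => c.size + d.size
  | .ite e c d => e.cost + c.size + d.size + 1
  | .rep _ _ c => c.size + 10

/-- The variables bounding the loops of a command. -/
def Cmd.bounds : Cmd → List ℕ
  | .skip | .set .. | .put .. | .wr _ => []
  | .seq c d | .ite _ c d => c.bounds ++ d.bounds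
  | .rep _ y c => y :: c.bounds

/-- Since the command never changes a variable of `L`, the bound `M` holds throughout the run, and
each level of nesting costs at most a factor `M + 1`. Commands that compute their own loop bounds
have to be split before this applies. -/
theorem Cmd.time_le (M : ℕ) (L : List ℕ) (c : Cmd) : (∀ y ∈ c.bounds, y ∈ L) →
    (∀ y ∈ L, y ∉ c.vars) → ∀ σ : Env, (∀ y ∈ L, σ.var y ≤ M) →
    c.time B inp σ ≤ c.size * (M + 1) ^ c.depth := by
  have mono : ∀ {a b : ℕ}, a ≤ b → (M + 1) ^ a ≤ (M + 1) ^ b := fun h =>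
    Nat.pow_le_pow_right (by omega) h
  induction c with
  | skip | set | put | wr => intro _ _ σ _; simp [Cmd.time, Cmd.size, Cmd.depth]
  | seq c d hc hd =>
    intro h1 h2 σ hσ
    simp only [Cmd.bounds, List.mem_append, Cmd.vars, not_or] at h1 h2
    have a := hc (fun y hy => h1 y (.inl hy)) (fun y hy => (h2 y hy).1) σ hσ
    have b := hd (fun y hy => h1 y (.inr hy)) (fun y hy => (h2 y hy).2) (c.run B inp σ)
      (fun y hy => by rw [(c.frame B inp σ).var y (h2 y hy).1]; exact hσ y hy)
    simp only [Cmd.time, Cmd.size, Cmd.depth, add_mul]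
    exact add_le_add (a.trans (Nat.mul_le_mul le_rfl (mono (le_max_left _ _))))
      (b.trans (Nat.mul_le_mul le_rfl (mono (le_max_right _ _))))
  | ite e c d hc hd =>
    intro h1 h2 σ hσ
    simp only [Cmd.bounds, List.mem_append, Cmd.vars, not_or] at h1 h2
    have a := (hc (fun y hy => h1 y (.inl hy)) (fun y hy => (h2 y hy).1) σ hσ).trans
      (Nat.mul_le_mul le_rfl (mono (le_max_left _ d.depth)))
    have b := (hd (fun y hy => h1 y (.inr hy)) (fun y hy => (h2 y hy).2) σ hσ).trans
      (Nat.mul_le_mul le_rfl (mono (le_max_right c.depth _)))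
    simp only [Cmd.time, Cmd.size, Cmd.depth]
    have p : 1 ≤ (M + 1) ^ max c.depth d.depth := Nat.one_le_pow _ _ (by omega)
    generalize (M + 1) ^ max c.depth d.depth = q at *
    have := Nat.mul_le_mul (le_refl e.cost) p
    split_ifs <;> simp only [add_mul] <;> omega
  | rep x y c hc =>
    intro h1 h2 σ hσ
    simp only [Cmd.bounds, List.mem_cons, Cmd.vars, not_or] at h1 h2
    have hy : σ.var y ≤ M := hσ y (h1 y (.inl rfl))
    simp only [Cmd.time, Cmd.size, Cmd.depth]
    have step : ∀ i ∈ Finset.range (σ.var y),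
        c.time B inp ((iterFor (c.run B inp) x i σ).set x i) + 6 ≤
          c.size * (M + 1) ^ c.depth + 6 := by
      intro i _
      gcongr
      refine hc (fun z hz => h1 z (.inr hz)) (fun z hz => (h2 z hz).2) _ fun z hz => ?_
      rw [Env.set_var, if_neg (h2 z hz).1,
        (iterFor_frame (c.frame B inp) x y σ i).var z (by simp [Cmd.vars, h2 z hz])]
      exact hσ z hz
    have := Finset.sum_le_card_nsmul _ _ _ step
    rw [Finset.card_range, smul_eq_mul] at this
    have p : 1 ≤ (M + 1) ^ c.depth := Nat.one_le_pow _ _ (by omega)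
    calc _ ≤ σ.var y * (c.size * (M + 1) ^ c.depth + 6) + 4 := by omega
      _ ≤ M * (c.size * (M + 1) ^ c.depth + 6) + 4 := by gcongr
      _ ≤ M * (c.size * (M + 1) ^ c.depth + 6 * (M + 1) ^ c.depth) + 4 * (M + 1) ^ c.depth := by
        gcongr <;> omega
      _ ≤ _ := by
        rw [pow_succ]; generalize (M + 1) ^ c.depth = q
        nlinarith [Nat.zero_le (c.size * q), Nat.zero_le (M * q)]

end Macro

/-! ### Partitions of the darts, deficiency and diminishing returns -/

namespace Merge

/-- Relabel the class of `b` to the label of `a`. -/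
def merge (L : ℕ → ℕ) (p : ℕ × ℕ) : ℕ → ℕ := fun c => if L c = L p.2 then L p.1 else L c

/-- Merge all pairs of a list. -/
def mergeAll (L : ℕ → ℕ) (l : List (ℕ × ℕ)) : ℕ → ℕ := l.foldl merge L

/-- `φ` does not separate what `L` identifies. -/
def Coarser (L φ : ℕ → ℕ) : Prop := ∀ a b, L a = L b → φ a = φ b

theorem coarser_merge_iff (L φ : ℕ → ℕ) (p : ℕ × ℕ) :
    Coarser (merge L p) φ ↔ Coarser L φ ∧ φ p.1 = φ p.2 := by
  constructor
  · refine fun h => ⟨fun a b hab => h a b (by simp [merge, hab]), h _ _ (by simp [merge])⟩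
  · rintro ⟨h, hp⟩ a b hab
    simp only [merge] at hab
    split_ifs at hab with h1 h2 h2
    · rw [h _ _ h1, h _ _ h2]
    · rw [h _ _ h1, ← hp, h _ _ hab]
    · rw [h _ _ h2, ← hp, h _ _ hab]
    · exact h _ _ hab

/-- The universal property of merging: as a partition, the result is the finest one that is coarser
than `L` and identifies the listed pairs. It makes the order and repetition of merges irrelevant. -/
theorem coarser_mergeAll_iff (φ : ℕ → ℕ) (l : List (ℕ × ℕ)) : ∀ L : ℕ → ℕ,
    Coarser (mergeAll L l) φ ↔ Coarser L φ ∧ ∀ p ∈ l, φ p.1 = φ p.2 := by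
  induction l with
  | nil => simp [mergeAll]
  | cons p l ih =>
    intro L
    rw [show mergeAll L (p :: l) = mergeAll (merge L p) l from rfl, ih, coarser_merge_iff]
    simp [and_assoc]

theorem coarser_refl (L : ℕ → ℕ) : Coarser L L := fun _ _ h => h

theorem mergeAll_pair {L : ℕ → ℕ} {l : List (ℕ × ℕ)} {p : ℕ × ℕ} (h : p ∈ l) :
    mergeAll L l p.1 = mergeAll L l p.2 :=
  ((coarser_mergeAll_iff _ l L).1 (coarser_refl _)).2 p h

/-- The number of classes on `D`. -/
def classes (D : Finset ℕ) (L : ℕ → ℕ) : ℕ := (D.image L).card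

/-- Sending the `L`-class of a representative to its `L'`-class is a surjection. -/
theorem classes_anti {D : Finset ℕ} {L L' : ℕ → ℕ} (h : Coarser L L') :
    classes D L' ≤ classes D L := by
  classical
  choose f hf using fun c : (D.image L) => Finset.mem_image.1 c.2
  have : D.image L' ⊆ (Finset.univ : Finset (D.image L)).image fun c => L' (f c) := by
    intro c hc
    obtain ⟨a, ha, rfl⟩ := Finset.mem_image.1 hc
    exact Finset.mem_image.2 ⟨⟨L a, Finset.mem_image_of_mem _ ha⟩, Finset.mem_univ _,
      h _ _ (hf _).2⟩
  exact ((Finset.card_le_card this).trans Finset.card_image_le).trans (by simp [classes])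

/-- A merge of two different classes removes exactly the label `L p.2`; a merge inside one class
changes nothing. -/
theorem classes_merge {D : Finset ℕ} {p : ℕ × ℕ} (h1 : p.1 ∈ D) (h2 : p.2 ∈ D) (L : ℕ → ℕ) :
    classes D (merge L p) + (if L p.1 = L p.2 then 0 else 1) = classes D L := by
  split_ifs with h
  · have : merge L p = L := by
      funext c; simp only [merge]; split_ifs with hc
      · rw [hc, h]
      · rfl
    rw [this, add_zero]
  · have : D.image (merge L p) = (D.image L).erase (L p.2) := by
      ext c
      simp only [Finset.mem_image, Finset.mem_erase, merge]
      constructor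
      · rintro ⟨a, ha, rfl⟩
        split_ifs with hc
        · exact ⟨h, _, h1, rfl⟩
        · exact ⟨hc, _, ha, rfl⟩
      · rintro ⟨hc, a, ha, rfl⟩
        exact ⟨a, ha, by rw [if_neg hc]⟩
    rw [classes, this, Finset.card_erase_add_one (Finset.mem_image_of_mem _ h2), classes]

theorem coarser_merge_mono {L L' : ℕ → ℕ} (h : Coarser L L') (p : ℕ × ℕ) :
    Coarser (merge L p) (merge L' p) :=
  (coarser_merge_iff _ _ _).2 ⟨fun a b hab => by simp [merge, h a b hab], by simp [merge]⟩

/-- Merging loses fewer classes in a coarser partition. -/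
theorem classes_submodular {D : Finset ℕ} {l : List (ℕ × ℕ)} (hl : ∀ p ∈ l, p.1 ∈ D ∧ p.2 ∈ D) :
    ∀ {L L' : ℕ → ℕ}, Coarser L L' →
      classes D L' + classes D (mergeAll L l) ≤ classes D L + classes D (mergeAll L' l) := by
  induction l with
  | nil => intro L L' _; simp [mergeAll, add_comm]
  | cons p l ih =>
    intro L L' h
    have := ih (fun q hq => hl q (by simp [hq])) (coarser_merge_mono h p)
    simp only [mergeAll, List.foldl_cons] at this ⊢
    obtain ⟨p1, p2⟩ := hl p (by simp)
    have a := classes_merge p1 p2 L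
    have b := classes_merge p1 p2 L'
    -- A pair already identified in the finer partition is identified in the coarser one, so a merge
    -- that is effective for `L'` is effective for `L`.
    have c : (if L' p.1 = L' p.2 then 0 else 1) ≤ (if L p.1 = L p.2 then 0 else 1) := by
      split_ifs with x y y
      · simp
      · simp
      · exact absurd (h _ _ y) x
      · simp
    omega

section Graph

variable (n : ℕ) (inp : ℕ → ℕ)

/-- The cells of the adjacency matrix that hold an edge. -/
def darts : Finset ℕ := (Finset.range (n * n)).filter fun a => inp a ≠ 0

/-- The pairs of darts that are merged because of vertex `v`, dart `(v, j)` and `k < m`. -/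
def pairsK (v j m : ℕ) : List (ℕ × ℕ) :=
  (List.range m).flatMap fun k => if inp (k * n + v) ≠ 0 then [(v * n + j, k * n + v)] else []

/-- The pairs of darts that are merged because of vertex `v` and darts `(v, j)`, `j < m`. -/
def pairsJ (v m : ℕ) : List (ℕ × ℕ) :=
  (List.range m).flatMap fun j => if inp (v * n + j) ≠ 0 then pairsK n inp v j n else []

/-- The pairs of darts that are merged because of vertices `v < m` in the set given by `z`. -/
def pairs (z : ℕ → ℕ) (m : ℕ) : List (ℕ × ℕ) :=
  (List.range m).flatMap fun v => if z v ≠ 0 then pairsJ n inp v n else []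

theorem mem_pairs {z : ℕ → ℕ} {m : ℕ} {p : ℕ × ℕ} : p ∈ pairs n inp z m ↔
    ∃ v < m, z v ≠ 0 ∧ ∃ j < n, inp (v * n + j) ≠ 0 ∧ ∃ k < n, inp (k * n + v) ≠ 0 ∧
      p = (v * n + j, k * n + v) := by
  simp only [pairs, pairsJ, pairsK, List.mem_flatMap, List.mem_range, List.mem_ite_nil_right,
    List.mem_singleton]

/-- The number of classes of darts after merging the darts at each vertex of `z`. -/
def deficiency (z : ℕ → ℕ) : ℕ := classes (darts n inp) (mergeAll id (pairs n inp z n))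

variable {n inp}

theorem cell_lt {i j : ℕ} (hi : i < n) (hj : j < n) : i * n + j < n * n := by nlinarith

theorem pairs_darts {z : ℕ → ℕ} : ∀ p ∈ pairs n inp z n, p.1 ∈ darts n inp ∧ p.2 ∈ darts n inp := by
  intro p hp
  obtain ⟨v, hv, -, j, hj, h1, k, hk, h2, rfl⟩ := (mem_pairs n inp).1 hp
  simp [darts, cell_lt, *]

theorem deficiency_anti {z z' : ℕ → ℕ} (h : ∀ v < n, z v ≠ 0 → z' v ≠ 0) :
    deficiency n inp z' ≤ deficiency n inp z := by
  refine classes_anti ((coarser_mergeAll_iff _ _ _).2 ⟨fun a b hab => by rw [show a = b from hab],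
    fun p hp => mergeAll_pair ?_⟩)
  obtain ⟨v, hv, h0, h1⟩ := (mem_pairs n inp).1 hp
  exact (mem_pairs n inp).2 ⟨v, hv, h v hv h0, h1⟩

theorem deficiency_congr {z z' : ℕ → ℕ} (h : ∀ v < n, z v ≠ 0 ↔ z' v ≠ 0) :
    deficiency n inp z' = deficiency n inp z :=
  le_antisymm (deficiency_anti fun v hv => (h v hv).1) (deficiency_anti fun v hv => (h v hv).2)

/-- Merging for a union can be done in two stages, since only the set of merged pairs matters for
the partition. -/
theorem deficiency_join {z w u : ℕ → ℕ} (h : ∀ v < n, u v ≠ 0 ↔ z v ≠ 0 ∨ w v ≠ 0) :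
    deficiency n inp u =
      classes (darts n inp) (mergeAll (mergeAll id (pairs n inp z n)) (pairs n inp w n)) := by
  have e : mergeAll (mergeAll id (pairs n inp z n)) (pairs n inp w n) =
      mergeAll id (pairs n inp z n ++ pairs n inp w n) := by simp [mergeAll]
  have hm : ∀ p, p ∈ pairs n inp u n ↔ p ∈ pairs n inp z n ++ pairs n inp w n := by
    intro p
    simp only [List.mem_append, mem_pairs]
    constructor
    · rintro ⟨v, hv, h0, h1⟩
      exact ((h v hv).1 h0).imp (fun h2 => ⟨v, hv, h2, h1⟩) (fun h2 => ⟨v, hv, h2, h1⟩)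
    · rintro (⟨v, hv, h0, h1⟩ | ⟨v, hv, h0, h1⟩)
      exacts [⟨v, hv, (h v hv).2 (.inl h0), h1⟩, ⟨v, hv, (h v hv).2 (.inr h0), h1⟩]
  rw [e]
  refine le_antisymm (classes_anti ?_) (classes_anti ?_) <;>
  refine (coarser_mergeAll_iff _ _ _).2 ⟨fun a b hab => by rw [show a = b from hab],
    fun p hp => mergeAll_pair ?_⟩
  exacts [(hm p).2 hp, (hm p).1 hp]

theorem deficiency_submodular {z z' w u u' : ℕ → ℕ} (hz : ∀ v < n, z v ≠ 0 → z' v ≠ 0)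
    (hu : ∀ v < n, u v ≠ 0 ↔ z v ≠ 0 ∨ w v ≠ 0) (hu' : ∀ v < n, u' v ≠ 0 ↔ z' v ≠ 0 ∨ w v ≠ 0) :
    deficiency n inp z' + deficiency n inp u ≤ deficiency n inp z + deficiency n inp u' := by
  rw [deficiency_join hu, deficiency_join hu']
  refine classes_submodular pairs_darts ((coarser_mergeAll_iff _ _ _).2
    ⟨fun a b hab => by rw [show a = b from hab], fun p hp => mergeAll_pair ?_⟩)
  obtain ⟨v, hv, h0, h1⟩ := (mem_pairs n inp).1 hp
  exact (mem_pairs n inp).2 ⟨v, hv, hz v hv h0, h1⟩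

theorem deficiency_pos (h : (darts n inp).Nonempty) (z : ℕ → ℕ) : 1 ≤ deficiency n inp z :=
  Finset.card_pos.2 (h.image _)

theorem deficiency_le (z : ℕ → ℕ) : deficiency n inp z ≤ n * n :=
  (Finset.card_image_le.trans (Finset.card_filter_le _ _)).trans (Finset.card_range _).le

/-- The indicator function of a set of vertices. -/
def ind (Z : Finset (Fin n)) : ℕ → ℕ := fun v => if ∃ h : v < n, (⟨v, h⟩ : Fin n) ∈ Z then 1 else 0

/-- The set of vertices given by its indicator function. -/
def toSet (n : ℕ) (z : ℕ → ℕ) : Finset (Fin n) := Finset.univ.filter fun v => z v ≠ 0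

theorem ind_ne {Z : Finset (Fin n)} {v : ℕ} (h : v < n) : ind Z v ≠ 0 ↔ (⟨v, h⟩ : Fin n) ∈ Z := by
  simp [ind, h]

theorem mem_toSet {z : ℕ → ℕ} {v : Fin n} : v ∈ toSet n z ↔ z v ≠ 0 := by simp [toSet]

variable (inp)

/-- Deficiency of a set of vertices. -/
def defi (Z : Finset (Fin n)) : ℕ := deficiency n inp (ind Z)

variable {inp}

theorem defi_toSet (z : ℕ → ℕ) : defi inp (toSet n z) = deficiency n inp z :=
  deficiency_congr fun v hv => by rw [ind_ne hv, mem_toSet]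

theorem defi_anti {Z Z' : Finset (Fin n)} (h : Z ⊆ Z') : defi inp Z' ≤ defi inp Z :=
  deficiency_anti fun v hv => by rw [ind_ne hv, ind_ne hv]; exact @h _

theorem defi_submodular {Z Z' : Finset (Fin n)} (h : Z ⊆ Z') (y : Fin n) :
    defi inp Z' + defi inp (insert y Z) ≤ defi inp Z + defi inp (insert y Z') := by
  refine deficiency_submodular (w := ind {y}) (fun v hv => ?_) (fun v hv => ?_) (fun v hv => ?_)
  · rw [ind_ne hv, ind_ne hv]; exact @h _
  all_goals rw [ind_ne hv, ind_ne hv, ind_ne hv]; simp [or_comm]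

end Graph

/-! ### Short unions of pieces that lead to a new solution -/

/-- The vertices whose addition to `Z` removes less than half of the excess deficiency. -/
def light {n : ℕ} (inp : ℕ → ℕ) (Z : Finset (Fin n)) : Finset (Fin n) :=
  Finset.univ.filter fun y =>
    2 * (defi inp Z - defi inp (insert y Z)) < defi inp Z - 1

/-- The sets that are unions of `d` pieces, each a vertex or a member of `ℋ` less one vertex. -/
inductive Reach {n : ℕ} (ℋ : List (Finset (Fin n))) : ℕ → Finset (Fin n) → Prop
  | nil : Reach ℋ 0 ∅
  | vertex {d Z} (y : Fin n) : Reach ℋ d Z → Reach ℋ (d + 1) (insert y Z)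
  | erase {d Z H} (y : Fin n) : Reach ℋ d Z → H ∈ ℋ → Reach ℋ (d + 1) (Z ∪ H.erase y)

/-- Each added piece at least halves the excess while `Z` stays inside the maximal set `X`; `e`
counts the halvings still allowed. -/
theorem exists_candidate_aux {n : ℕ} {inp : ℕ → ℕ} (hD : (darts n inp).Nonempty)
    {ℋ : List (Finset (Fin n))} (hℋ : ∀ H ∈ ℋ, defi inp H = 1) {X : Finset (Fin n)}
    (hX : ∀ H ∈ ℋ, ¬ H ⊆ X) (hf : defi inp X = 1)
    (hmax : ∀ y, y ∉ X → ∃ H ∈ ℋ, H ⊆ insert y X) (e : ℕ) :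
    ∀ (d : ℕ) (Z : Finset (Fin n)), Reach ℋ d Z → Z ⊆ X → defi inp Z - 1 < 2 ^ e →
      ∃ d' ≤ d + e, ∃ Z', Reach ℋ d' Z' ∧ defi inp (Z' ∪ light inp Z') = 1 ∧
        ∀ H ∈ ℋ, ¬ H ⊆ Z' ∪ light inp Z' := by
  have pos : ∀ Z : Finset (Fin n), 1 ≤ defi inp Z := fun Z => deficiency_pos hD _
  induction e with
  | zero =>
    intro d Z hZ hZX h
    have h1 : defi inp Z = 1 := by have := pos Z; omega
    -- Without excess the strict inequality defining lightness reads `0 < 0`.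
    have h2 : light inp Z = ∅ := by simp [light, h1]
    refine ⟨d, by omega, Z, hZ, ?_⟩
    rw [h2, Finset.union_empty]
    exact ⟨h1, fun H hH hs => hX H hH (hs.trans hZX)⟩
  | succ e ih =>
    intro d Z hZ hZX h
    by_cases h1 : ∃ y ∈ light inp Z, y ∉ X
    · obtain ⟨y, hy, hyX⟩ := h1
      obtain ⟨H, hH, hs⟩ := hmax y hyX
      have hsub : Z ∪ H.erase y ⊆ X := Finset.union_subset hZX fun v hv =>
        (Finset.mem_insert.1 (hs (Finset.mem_of_mem_erase hv))).resolve_left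
          (Finset.ne_of_mem_erase hv)
      have h3 : defi inp (insert y (Z ∪ H.erase y)) = 1 := by
        refine le_antisymm ?_ (pos _)
        rw [← hℋ H hH]
        refine defi_anti fun v hv => ?_
        by_cases hvy : v = y <;> simp [hvy, hv]
      -- Adding `y` to the enlarged set brings its deficiency to one, so its excess is at most the
      -- drop that `y` causes at `Z`, less than half the old excess.
      have h4 := defi_submodular (inp := inp) (Z := Z) (Z' := Z ∪ H.erase y) Finset.subset_union_left y
      simp only [light, Finset.mem_filter] at hy
      obtain ⟨d', hd', r⟩ := ih (d + 1) (Z ∪ H.erase y) (.erase y hZ hH) hsub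
        (by rw [pow_succ] at h; omega)
      exact ⟨d', by omega, r⟩
    · push Not at h1
      by_cases h2 : ∃ y ∈ X, y ∉ Z ∪ light inp Z
      · obtain ⟨y, hyX, hy⟩ := h2
        simp only [Finset.mem_union, light, Finset.mem_filter, Finset.mem_univ, true_and,
          not_or, not_lt] at hy
        have h3 : defi inp (insert y Z) ≤ defi inp Z := defi_anti (Finset.subset_insert _ _)
        have := pos Z
        have := pos (insert y Z)
        obtain ⟨d', hd', r⟩ := ih (d + 1) (insert y Z) (.vertex y hZ)
          (Finset.insert_subset hyX hZX) (by rw [pow_succ] at h; omega)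
        exact ⟨d', by omega, r⟩
      · push Not at h2
        have : Z ∪ light inp Z = X :=
          Finset.Subset.antisymm (Finset.union_subset hZX h1) h2
        exact ⟨d, by omega, Z, hZ, by rwa [this], by rwa [this]⟩

/-- If some feasible set contains no member of `ℋ`, then a short union of pieces leads to one. -/
theorem exists_candidate {n : ℕ} {inp : ℕ → ℕ} (hD : (darts n inp).Nonempty)
    {ℋ : List (Finset (Fin n))} (hℋ : ∀ H ∈ ℋ, defi inp H = 1) {X : Finset (Fin n)}
    (hX : ∀ H ∈ ℋ, ¬ H ⊆ X) (hf : defi inp X = 1) {e : ℕ} (he : n * n ≤ 2 ^ e) :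
    ∃ d ≤ e, ∃ Z, Reach ℋ d Z ∧ defi inp (Z ∪ light inp Z) = 1 ∧
      ∀ H ∈ ℋ, ¬ H ⊆ Z ∪ light inp Z := by
  -- Maximality supplies, for each vertex outside `Y`, a member of `ℋ` that its addition would
  -- complete.
  obtain ⟨Y, hXY, hY⟩ := Set.Finite.exists_le_maximal
    (Set.toFinite {Y : Finset (Fin n) | ∀ H ∈ ℋ, ¬ H ⊆ Y}) hX
  have h1 : defi inp Y = 1 :=
    le_antisymm (hf ▸ defi_anti hXY) (deficiency_pos hD _)
  obtain ⟨d, hd, r⟩ := exists_candidate_aux hD hℋ hY.prop h1 (fun y hy => by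
    by_contra hc
    push Not at hc
    exact hy (hY.le_of_ge hc (Finset.subset_insert y Y) (Finset.mem_insert_self y Y)))
    e 0 ∅ .nil (Finset.empty_subset _)
    (by have : defi inp (∅ : Finset (Fin n)) ≤ n * n := deficiency_le _
        have := deficiency_pos hD (ind (∅ : Finset (Fin n)))
        change 1 ≤ defi inp (∅ : Finset (Fin n)) at this
        omega)
  exact ⟨d, by omega, r⟩

end Merge

/-! ### Connected vertex covers as sets of deficiency one -/

namespace Merge
open RAM

variable {n : ℕ} (G : SimpleGraph (Fin n))

theorem cell_inj {i j k l : ℕ} (hj : j < n) (hl : l < n) (h : i * n + j = k * n + l) :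
    i = k ∧ j = l := by
  have h1 : i = k := by
    have a := congrArg (· / n) h
    have hn : 0 < n := by omega
    simpa [Nat.add_div_of_dvd_right, Nat.mul_add_div, Nat.mul_comm _ n, Nat.div_eq_of_lt hj,
      Nat.div_eq_of_lt hl, Nat.mul_add_div hn] using a
  subst h1
  exact ⟨rfl, by omega⟩

theorem input_ne {i j : ℕ} (hi : i < n) (hj : j < n) :
    (graphInput G).mem (i * n + j) ≠ 0 ↔ G.Adj ⟨i, hi⟩ ⟨j, hj⟩ := by
  simp only [graphInput, ne_eq, ite_eq_right_iff, one_ne_zero, imp_false, not_not]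
  constructor
  · rintro ⟨a, b, h, e⟩
    obtain ⟨rfl, rfl⟩ := cell_inj hj b.2 e
    exact h
  · exact fun h => ⟨_, _, h, rfl⟩

theorem mem_darts {c : ℕ} : c ∈ darts n (graphInput G).mem ↔
    ∃ i j : Fin n, G.Adj i j ∧ c = i * n + j := by
  simp only [darts, Finset.mem_filter, Finset.mem_range]
  constructor
  · rintro ⟨-, h⟩
    simpa [graphInput] using h
  · rintro ⟨i, j, h, rfl⟩
    exact ⟨cell_lt i.2 j.2, (input_ne G i.2 j.2).2 h⟩

theorem defi_eq_one_iff (hD : (darts n (graphInput G).mem).Nonempty) (Z : Finset (Fin n)) :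
    defi (graphInput G).mem Z = 1 ↔ ∀ i j k l : Fin n, G.Adj i j → G.Adj k l →
      mergeAll id (pairs n (graphInput G).mem (ind Z) n) (i * n + j) =
      mergeAll id (pairs n (graphInput G).mem (ind Z) n) (k * n + l) := by
  constructor
  · intro h i j k l h1 h2
    rw [defi, deficiency, classes] at h
    obtain ⟨c, hc⟩ := Finset.card_eq_one.1 h
    have key : ∀ i j : Fin n, G.Adj i j →
        mergeAll id (pairs n (graphInput G).mem (ind Z) n) (i * n + j) = c := fun i j h => by
      have := Finset.mem_image_of_mem (mergeAll id (pairs n (graphInput G).mem (ind Z) n))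
        ((mem_darts G).2 ⟨i, j, h, rfl⟩)
      rw [hc] at this
      simpa using this
    rw [key i j h1, key k l h2]
  · intro h
    refine le_antisymm ?_ (deficiency_pos hD _)
    rw [defi, deficiency, classes, Finset.card_le_one]
    intro a ha b hb
    obtain ⟨a, ha', rfl⟩ := Finset.mem_image.1 ha
    obtain ⟨b, hb', rfl⟩ := Finset.mem_image.1 hb
    obtain ⟨i, j, h1, rfl⟩ := (mem_darts G).1 ha'
    obtain ⟨k, l, h2, rfl⟩ := (mem_darts G).1 hb'
    exact h i j k l h1 h2

theorem mem_pairs_input {Z : Finset (Fin n)} {p : ℕ × ℕ} :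
    p ∈ pairs n (graphInput G).mem (ind Z) n ↔ ∃ v ∈ Z, ∃ j k, G.Adj v j ∧ G.Adj k v ∧
      p = ((v : ℕ) * n + (j : ℕ), (k : ℕ) * n + (v : ℕ)) := by
  rw [mem_pairs]
  constructor
  · rintro ⟨v, hv, h0, j, hj, h1, k, hk, h2, rfl⟩
    exact ⟨⟨v, hv⟩, (ind_ne hv).1 h0, ⟨j, hj⟩, ⟨k, hk⟩, (input_ne G hv hj).1 h1,
      (input_ne G hk hv).1 h2, rfl⟩
  · rintro ⟨v, h0, j, k, h1, h2, rfl⟩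
    exact ⟨v, v.2, (ind_ne v.2).2 h0, j, j.2, (input_ne G v.2 j.2).2 h1, k, k.2,
      (input_ne G k.2 v.2).2 h2, rfl⟩

/-- Every dart has an end in `C`, hence the label of some dart leaving a vertex of `C`, and
connectedness makes all those labels equal. -/
theorem defi_eq_one_of_cover (hD : (darts n (graphInput G).mem).Nonempty) {C : Finset (Fin n)}
    (hC : IsConnectedVertexCover G C) : defi (graphInput G).mem C = 1 := by
  rw [defi_eq_one_iff G hD]
  obtain ⟨hcov, hcon⟩ := hC
  set L := mergeAll id (pairs n (graphInput G).mem (ind C) n) with hL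
  have hp : ∀ v ∈ C, ∀ j k, G.Adj v j → G.Adj k v → L (v * n + j) = L (k * n + v) :=
    fun v hv j k h1 h2 => mergeAll_pair (p := ((v : ℕ) * n + (j : ℕ), (k : ℕ) * n + (v : ℕ)))
      ((mem_pairs_input G).2 ⟨v, hv, j, k, h1, h2, rfl⟩)
  -- all darts at a vertex of `C` have one label, which is constant along walks in `C`
  have walk : ∀ u v : (C : Set (Fin n)), (G.induce (C : Set (Fin n))).Reachable u v →
      ∀ j k, G.Adj u j → G.Adj v k → L (u * n + j) = L (v * n + k) := by
    rintro u v ⟨w⟩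
    induction w with
    | nil =>
      intro j k h1 h2
      -- Merges pair a leaving dart with an entering one, so two leaving darts are compared through
      -- an entering dart.
      rw [hp _ (Finset.mem_coe.1 (Subtype.prop _)) j j h1 h1.symm,
        hp _ (Finset.mem_coe.1 (Subtype.prop _)) k j h2 h1.symm]
    | @cons u v w h q ih =>
      intro j k h1 h2
      have h : G.Adj u v := h
      -- The dart from `v` to `u` enters `u` and leaves `v`, which carries the label along the edge.
      rw [hp u u.2 j v h1 h.symm]
      exact ih _ _ h.symm h2
  have key : ∀ i j : Fin n, G.Adj i j → ∃ u : (C : Set (Fin n)), ∃ k, G.Adj u k ∧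
      L (i * n + j) = L (u * n + k) := by
    intro i j h
    rcases hcov h with hi | hj
    · exact ⟨⟨i, hi⟩, j, h, rfl⟩
    · exact ⟨⟨j, hj⟩, i, h.symm, (hp j hj i i h.symm h).symm⟩
  intro i j k l h1 h2
  obtain ⟨u, a, hu, e1⟩ := key i j h1
  obtain ⟨v, b, hv, e2⟩ := key k l h2
  rw [e1, e2]
  exact walk u v (hcon.preconnected u v) a b hu hv

/-- By the universal property, a function on darts that respects the merges at `Z` is constant.
Suitable indicator functions then show that `Z` is a vertex cover and that its non-isolated vertices
induce a connected subgraph. -/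
theorem cover_of_defi_eq_one (hD : (darts n (graphInput G).mem).Nonempty) {Z : Finset (Fin n)}
    (hZ : defi (graphInput G).mem Z = 1) : ∃ C ⊆ Z, IsConnectedVertexCover G C := by
  classical
  rw [defi_eq_one_iff G hD] at hZ
  set L := mergeAll id (pairs n (graphInput G).mem (ind Z) n) with hL
  have univ : ∀ φ : Fin n → Fin n → ℕ, (∀ v ∈ Z, ∀ j k, G.Adj v j → G.Adj k v → φ v j = φ k v) →
      ∀ i j k l : Fin n, G.Adj i j → G.Adj k l → φ i j = φ k l := by
    intro φ hφ i j k l h1 h2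
    let ψ : ℕ → ℕ := fun c => if h : ∃ p : Fin n × Fin n, c = p.1 * n + p.2 then
      φ h.choose.1 h.choose.2 else 0
    have hψ : ∀ i j : Fin n, ψ (i * n + j) = φ i j := by
      intro i j
      have h : ∃ p : Fin n × Fin n, (i * n + j : ℕ) = p.1 * n + p.2 := ⟨(i, j), rfl⟩
      have e := cell_inj (Fin.is_lt _) (Fin.is_lt _) h.choose_spec
      simp only [ψ, dif_pos h]
      rw [← Fin.ext e.1, ← Fin.ext e.2]
    have hc : Coarser L ψ := (coarser_mergeAll_iff _ _ _).2
      ⟨fun a b hab => by rw [show a = b from hab], fun p hp => by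
        obtain ⟨v, hv, j, k, h1, h2, rfl⟩ := (mem_pairs_input G).1 hp
        simp only [hψ]
        exact hφ v hv j k h1 h2⟩
    rw [← hψ, ← hψ]
    exact hc _ _ (hZ i j k l h1 h2)
  have hcov : ∀ i j, G.Adj i j → i ∈ Z ∨ j ∈ Z := by
    intro i j h
    by_contra hc
    push Not at hc
    -- The indicator of one dart of an uncovered edge respects all merges but separates that dart
    -- from its reverse.
    have := univ (fun a b => if a = i ∧ b = j then 1 else 0) (fun v hv a b h1 h2 => by
      have h3 : v ≠ i := fun e => hc.1 (e ▸ hv)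
      have h4 : v ≠ j := fun e => hc.2 (e ▸ hv)
      simp [h3, h4]) i j j i h h.symm
    simp [h.ne'] at this
  let C := Z.filter fun v => ∃ w, G.Adj v w
  refine ⟨C, Finset.filter_subset _ _, fun i j h => ?_, ?_⟩
  · simp only [C, Finset.coe_filter, Set.mem_ofPred_eq]
    exact (hcov i j h).imp (fun hi => ⟨hi, j, h⟩) (fun hj => ⟨hj, i, h.symm⟩)
  have hCn : Nonempty (C : Set (Fin n)) := by
    obtain ⟨c, hc⟩ := hD
    obtain ⟨i, j, h, -⟩ := (mem_darts G).1 hc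
    rcases hcov i j h with hi | hj
    · exact ⟨⟨i, by simpa [C] using ⟨hi, j, h⟩⟩⟩
    · exact ⟨⟨j, by simpa [C] using ⟨hj, i, h.symm⟩⟩⟩
  have mk : ∀ v ∈ Z, ∀ w, G.Adj v w → v ∈ (C : Set (Fin n)) := fun v hv w h => by
    simpa [C] using ⟨hv, w, h⟩
  refine { preconnected := fun u v => ?_, nonempty := hCn }
  let near : Fin n → Prop := fun w => ∃ h : w ∈ (C : Set (Fin n)),
    (G.induce (C : Set (Fin n))).Reachable u ⟨w, h⟩
  have near_adj : ∀ a b, a ∈ (C : Set (Fin n)) → b ∈ (C : Set (Fin n)) → G.Adj a b →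
      (near a ↔ near b) := by
    intro a b ha hb h
    have e : (G.induce (C : Set (Fin n))).Adj ⟨a, ha⟩ ⟨b, hb⟩ := h
    exact ⟨fun ⟨_, r⟩ => ⟨hb, r.trans e.reachable⟩, fun ⟨_, r⟩ => ⟨ha, r.trans e.symm.reachable⟩⟩
  have hu : u.1 ∈ Z ∧ ∃ w, G.Adj u w := by simpa [C] using u.2
  have hv : v.1 ∈ Z ∧ ∃ w, G.Adj v w := by simpa [C] using v.2
  obtain ⟨hu, a, hua⟩ := hu
  obtain ⟨hv, b, hvb⟩ := hv
  -- Each dart is marked by whether an end of it in `Z` is reachable from `u`; if both ends are in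
  -- `Z`, adjacency makes the choice immaterial.
  have := univ (fun i j => if (if i ∈ Z then near i else near j) then 1 else 0)
    (fun w hw j k h1 h2 => by
      by_cases hk : k ∈ Z
      · simp only [hw, hk, if_true]
        simp only [near_adj k w (mk k hk w h2) (mk w hw j h1) h2]
      · simp only [hw, hk, if_true, if_false]) u a v b hua hvb
  have hnu : near u := ⟨u.2, .rfl⟩
  simp only [hu, hv, if_true, hnu] at this
  have hnv : near v := by by_contra hc; simp [hc] at this
  exact hnv.2

/-- Each of the two families contains a subset of every member of the other in the appropriate
direction: covers have deficiency one, and sets of deficiency one contain covers. This forces equal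
minimal members. -/
theorem minimal_cover_iff (hD : (darts n (graphInput G).mem).Nonempty) (C : Finset (Fin n)) :
    C ∈ minimalConnectedVertexCovers G ↔
      Minimal (fun Z : Finset (Fin n) => defi (graphInput G).mem Z = 1) C := by
  constructor
  · intro h
    refine ⟨defi_eq_one_of_cover G hD h.prop, fun Z hZ hs => ?_⟩
    obtain ⟨C', h1, h2⟩ := cover_of_defi_eq_one G hD hZ
    exact (h.le_of_le h2 (h1.trans hs)).trans h1
  · intro h
    obtain ⟨C', h1, h2⟩ := cover_of_defi_eq_one G hD h.prop
    have : C ≤ C' := h.le_of_le (defi_eq_one_of_cover G hD h2) h1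
    obtain rfl : C = C' := Finset.Subset.antisymm this h1
    exact ⟨h2, fun Z hZ hs => h.le_of_le (defi_eq_one_of_cover G hD hZ) hs⟩

theorem minimal_cover_iff_of_empty (hD : ¬ (darts n (graphInput G).mem).Nonempty)
    (C : Finset (Fin n)) : C ∈ minimalConnectedVertexCovers G ↔ ∃ v, C = {v} := by
  have hE : ∀ i j, ¬ G.Adj i j := fun i j h => hD ⟨_, (mem_darts G).2 ⟨i, j, h, rfl⟩⟩
  have single : ∀ v : Fin n, IsConnectedVertexCover G {v} := by
    intro v
    refine ⟨fun i j h => absurd h (hE i j), ?_⟩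
    have : Subsingleton ((({v} : Finset (Fin n)) : Set (Fin n))) := by simp
    exact { preconnected := .of_subsingleton, nonempty := ⟨⟨v, by simp⟩⟩ }
  constructor
  · intro h
    obtain ⟨⟨v, hv⟩⟩ := h.prop.2.nonempty
    have hv : v ∈ C := by simpa using hv
    have := h.le_of_le (single v) (by simpa using hv)
    exact ⟨v, Finset.Subset.antisymm this (by simpa using hv)⟩
  · rintro ⟨v, rfl⟩
    refine ⟨single v, fun Z hZ hs => ?_⟩
    obtain ⟨⟨w, hw⟩⟩ := hZ.2.nonempty
    have hw : w ∈ Z := by simpa using hw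
    have : w = v := by simpa using hs hw
    simpa using this ▸ hw

end Merge

/-! ### Computing the deficiency -/

namespace Merge
open Macro

/-- Zero exactly if the two expressions have equal values. -/
def dist (e f : Ex) : Ex := .add (.sub e f) (.sub f e)

theorem eval_dist {B : ℕ} {inp : ℕ → ℕ} {e f : Ex} {σ : Env} :
    (dist e f).eval B inp σ ≠ 0 ↔ e.eval B inp σ ≠ f.eval B inp σ := by
  simp only [dist, Ex.eval]; omega

/-- Relabel all cells labelled `var 15` by `var 14`. -/
def relabelCmd : Cmd :=
  .rep 13 1 (.ite (dist (.get 2 (.var 13)) (.var 15)) .skip (.put 2 (.var 13) (.var 14)))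

/-- Merge the darts `(v, j)` and `(k, v)`. -/
def mergeCmd : Cmd :=
  .seq (.set 14 (.get 2 (.add (.get 0 (.var 10)) (.var 11)))) <|
  .seq (.set 15 (.get 2 (.add (.get 0 (.var 12)) (.var 10)))) <|
  .ite (dist (.var 14) (.var 15)) (.seq (.set 16 (.sub (.var 16) (.lit 1))) relabelCmd) .skip

/-- Merge the dart `(v, j)` with all darts `(k, v)`. -/
def mergeK : Cmd :=
  .rep 12 0 (.ite (.inp (.add (.get 0 (.var 12)) (.var 10))) mergeCmd .skip)

/-- Merge all darts at `v`. -/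
def mergeJ : Cmd :=
  .rep 11 0 (.ite (.inp (.add (.get 0 (.var 10)) (.var 11))) mergeK .skip)

/-- Merge the darts at each vertex of the set in array `1`. -/
def mergeV : Cmd := .rep 10 0 (.ite (.get 1 (.var 10)) mergeJ .skip)

/-- Put the deficiency of the set in array `1` into `var 16`. -/
def defiCmd : Cmd :=
  .seq (.rep 10 1 (.put 2 (.var 10) (.var 10))) <| .seq (.set 16 (.var 2)) mergeV

/-- The constant tables used by the deficiency computation. -/
structure Tables (n : ℕ) (inp : ℕ → ℕ) (σ : Env) : Prop where
  size : σ.var 0 = n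
  sq : σ.var 1 = n * n
  card : σ.var 2 = (darts n inp).card
  row : ∀ i < n, σ.arr 0 i = i * n

theorem Tables.of_eq {n : ℕ} {inp : ℕ → ℕ} {σ τ : Env} (h : Tables n inp σ)
    (h0 : τ.var 0 = σ.var 0) (h1 : τ.var 1 = σ.var 1) (h2 : τ.var 2 = σ.var 2)
    (h3 : τ.arr 0 = σ.arr 0) : Tables n inp τ :=
  ⟨h0.trans h.size, h1.trans h.sq, h2.trans h.card, fun i hi => h3 ▸ h.row i hi⟩

theorem Tables.frame {n : ℕ} {inp : ℕ → ℕ} {σ τ : Env} {c : Cmd} (h : Tables n inp σ)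
    (hf : Frame c σ τ) (hc : (0 ∉ c.vars ∧ 1 ∉ c.vars ∧ 2 ∉ c.vars) ∧ 0 ∉ c.arrs) :
    Tables n inp τ :=
  h.of_eq (hf.var _ hc.1.1) (hf.var _ hc.1.2.1) (hf.var _ hc.1.2.2) (hf.arr _ hc.2)

theorem Tables.set {n : ℕ} {inp : ℕ → ℕ} {σ : Env} (h : Tables n inp σ) {x : ℕ} (hx : 3 ≤ x) (v : ℕ) :
    Tables n inp (σ.set x v) := by
  refine h.of_eq ?_ ?_ ?_ rfl <;> rw [Env.set_var, if_neg (by omega)]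

/-- Array `2` holds the labels `L`, and `var 16` the number of classes. -/
def Labels (n : ℕ) (inp L : ℕ → ℕ) (τ : Env) : Prop :=
  (∀ c < n * n, τ.arr 2 c = L c) ∧ τ.var 16 = classes (darts n inp) L

theorem Labels.set {n : ℕ} {inp L : ℕ → ℕ} {τ : Env} (h : Labels n inp L τ) {x : ℕ} (hx : x ≠ 16)
    (v : ℕ) : Labels n inp L (τ.set x v) :=
  ⟨h.1, by rw [Env.set_var, if_neg hx.symm, h.2]⟩

section

variable {n : ℕ} {inp : ℕ → ℕ}

/-- Both labels are kept in variables that the loop does not touch, so overwriting array `2` in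
place is safe. -/
theorem run_relabelCmd {σ : Env} {c : ℕ} (hc : c < σ.var 1) :
    (relabelCmd.run (n * n) inp σ).arr 2 c =
      if σ.arr 2 c = σ.var 15 then σ.var 14 else σ.arr 2 c := by
  have := Cmd.for_rule (B := n * n) (inp := inp) (x := 13) (y := 1)
    (c := .ite (dist (.get 2 (.var 13)) (.var 15)) .skip (.put 2 (.var 13) (.var 14))) (σ := σ)
    (fun i τ => ∀ c, τ.arr 2 c =
      if c < i ∧ σ.arr 2 c = σ.var 15 then σ.var 14 else σ.arr 2 c)
    (by simp) ?_ (fun i τ v h => h)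
  · have := this c
    simpa [hc, relabelCmd] using this
  · intro i hi τ hF hx hI c
    have e1 : τ.var 15 = σ.var 15 := hF.var 15 (by decide)
    have e2 : τ.var 14 = σ.var 14 := hF.var 14 (by decide)
    simp only [Cmd.run, eval_dist, Ex.eval, hx, e1, e2]
    by_cases h : σ.arr 2 i = σ.var 15
    · have : τ.arr 2 i = σ.var 15 := by rw [hI]; simp [h]
      rw [if_neg (by simp [this]), Env.put_arr, hI c]
      by_cases hc : c = i
      · simp [hc, h]
      · have : c < i + 1 ↔ c < i := by omega
        simp [hc, this]
    · have : τ.arr 2 i ≠ σ.var 15 := by rw [hI]; simp [h]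
      rw [if_pos this, hI c]
      by_cases hc : c = i
      · simp [hc, h]
      · have : c < i + 1 ↔ c < i := by omega
        simp [this]

/-- Both cells are darts, so a merge of different labels lowers the class count by exactly one; the
count is thus maintained without ever counting labels. -/
theorem run_mergeCmd {σ : Env} {L : ℕ → ℕ} (hT : Tables n inp σ) (hL : Labels n inp L σ)
    {v j k : ℕ} (hv : v < n) (hj : j < n) (hk : k < n) (h10 : σ.var 10 = v) (h11 : σ.var 11 = j)
    (h12 : σ.var 12 = k) (h1 : inp (v * n + j) ≠ 0) (h2 : inp (k * n + v) ≠ 0) :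
    Labels n inp (merge L (v * n + j, k * n + v)) (mergeCmd.run (n * n) inp σ) := by
  have l1 := cell_lt hv hj
  have l2 := cell_lt hk hv
  have m1 : v * n + j ∈ darts n inp := by simp [darts, l1, h1]
  have m2 : k * n + v ∈ darts n inp := by simp [darts, l2, h2]
  have hc := classes_merge (p := (v * n + j, k * n + v)) m1 m2 L
  simp only at hc
  simp only [mergeCmd, Cmd.run, eval_dist, Ex.eval, Env.set_var, Env.set_arr, h10, h11, h12,
    hT.row v hv, hL.1 _ l1]
  norm_num [h10, h12, hT.row k hk, hL.1 _ l2]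
  split_ifs with he
  · rw [if_pos he] at hc
    have : merge L (v * n + j, k * n + v) = L := by
      funext c; simp only [merge]; split_ifs with h
      · rw [h, he]
      · rfl
    rw [this]
    exact (hL.set (by norm_num) _).set (by norm_num) _
  · rw [if_neg he] at hc
    refine ⟨fun c hc => ?_, ?_⟩
    · rw [run_relabelCmd (by simpa [Env.set_var, hT.sq] using hc)]
      simp [Env.set_var, merge, hL.1 c hc]
    · rw [((relabelCmd.frame (n * n) inp) _).var 16 (by decide), Env.set_var, if_pos rfl, hL.2]
      omega

theorem mergeAll_append (L : ℕ → ℕ) (l l' : List (ℕ × ℕ)) :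
    mergeAll L (l ++ l') = mergeAll (mergeAll L l) l' := by simp [mergeAll]

theorem run_mergeK {σ : Env} {L : ℕ → ℕ} (hT : Tables n inp σ) (hL : Labels n inp L σ)
    {v j : ℕ} (hv : v < n) (hj : j < n) (h10 : σ.var 10 = v) (h11 : σ.var 11 = j)
    (h1 : inp (v * n + j) ≠ 0) :
    Labels n inp (mergeAll L (pairsK n inp v j n)) (mergeK.run (n * n) inp σ) := by
  have := Cmd.for_rule (B := n * n) (inp := inp) (x := 12) (y := 0)
    (c := .ite (.inp (.add (.get 0 (.var 12)) (.var 10))) mergeCmd .skip) (σ := σ)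
    (fun i τ => Labels n inp (mergeAll L (pairsK n inp v j i)) τ) hL ?_
    (fun i τ v h => h.set (by norm_num) _)
  · rwa [hT.size] at this
  · intro i hi τ hF hx hI
    rw [hT.size] at hi
    have tT := hT.frame hF (by decide)
    have e1 : τ.var 10 = v := (hF.var 10 (by decide)).trans h10
    have e2 : τ.var 11 = j := (hF.var 11 (by decide)).trans h11
    simp only [Cmd.run, Ex.eval, hx, e1, tT.row i hi, cell_lt hi hv, if_true]
    rw [pairsK, List.range_succ, List.flatMap_append, mergeAll_append]
    simp only [List.flatMap_cons, List.flatMap_nil, List.append_nil]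
    split_ifs with h
    · exact run_mergeCmd tT hI hv hj hi e1 e2 hx h1 h
    · exact hI

theorem run_mergeJ {σ : Env} {L : ℕ → ℕ} (hT : Tables n inp σ) (hL : Labels n inp L σ)
    {v : ℕ} (hv : v < n) (h10 : σ.var 10 = v) :
    Labels n inp (mergeAll L (pairsJ n inp v n)) (mergeJ.run (n * n) inp σ) := by
  have := Cmd.for_rule (B := n * n) (inp := inp) (x := 11) (y := 0)
    (c := .ite (.inp (.add (.get 0 (.var 10)) (.var 11))) mergeK .skip) (σ := σ)
    (fun i τ => Labels n inp (mergeAll L (pairsJ n inp v i)) τ) hL ?_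
    (fun i τ v h => h.set (by norm_num) _)
  · rwa [hT.size] at this
  · intro i hi τ hF hx hI
    rw [hT.size] at hi
    have tT := hT.frame hF (by decide)
    have e1 : τ.var 10 = v := (hF.var 10 (by decide)).trans h10
    simp only [Cmd.run, Ex.eval, hx, e1, tT.row v hv, cell_lt hv hi, if_true]
    rw [pairsJ, List.range_succ, List.flatMap_append, mergeAll_append]
    simp only [List.flatMap_cons, List.flatMap_nil, List.append_nil]
    split_ifs with h
    · exact run_mergeK tT hI hv hi e1 hx h
    · exact hI

theorem run_mergeV {σ : Env} {L : ℕ → ℕ} (hT : Tables n inp σ) (hL : Labels n inp L σ) :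
    Labels n inp (mergeAll L (pairs n inp (σ.arr 1) n)) (mergeV.run (n * n) inp σ) := by
  have := Cmd.for_rule (B := n * n) (inp := inp) (x := 10) (y := 0)
    (c := .ite (.get 1 (.var 10)) mergeJ .skip) (σ := σ)
    (fun i τ => Labels n inp (mergeAll L (pairs n inp (σ.arr 1) i)) τ) hL ?_
    (fun i τ v h => h.set (by norm_num) _)
  · rwa [hT.size] at this
  · intro i hi τ hF hx hI
    rw [hT.size] at hi
    have tT := hT.frame hF (by decide)
    have e1 : τ.arr 1 = σ.arr 1 := hF.arr 1 (by decide)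
    simp only [Cmd.run, Ex.eval, hx, e1]
    rw [pairs, List.range_succ, List.flatMap_append, mergeAll_append]
    simp only [List.flatMap_cons, List.flatMap_nil, List.append_nil]
    split_ifs with h
    · exact run_mergeJ tT hI hi hx
    · exact hI

/-- Under identity labels every dart is its own class, so the running count starts at the number of
darts. -/
theorem run_defiCmd {σ : Env} (hT : Tables n inp σ) :
    (defiCmd.run (n * n) inp σ).var 16 = deficiency n inp (σ.arr 1) := by
  set τ := Cmd.run (n * n) inp (.rep 10 1 (.put 2 (.var 10) (.var 10))) σ with hτ
  have hF : Frame (.rep 10 1 (.put 2 (.var 10) (.var 10))) σ τ := Cmd.frame _ _ _ _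
  have tT := hT.frame hF (by decide)
  have h := Cmd.for_rule (B := n * n) (inp := inp) (x := 10) (y := 1)
    (c := .put 2 (.var 10) (.var 10)) (σ := σ) (fun i τ => ∀ c < i, τ.arr 2 c = c)
    (by simp) (fun i hi τ hF hx hI c hc => by
      simp only [Cmd.run, Ex.eval, hx, Env.put_arr, true_and]
      split_ifs with h
      · exact h.symm
      · exact hI c (by omega)) (fun i τ v h => h)
  rw [hT.sq, ← hτ] at h
  have hL : Labels n inp id (τ.set 16 (τ.var 2)) :=
    ⟨h, by rw [Env.set_var, if_pos rfl, tT.card]; simp [classes]⟩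
  have := (run_mergeV (tT.set (by norm_num) _) hL).2
  rw [show (τ.set 16 (τ.var 2)).arr 1 = σ.arr 1 from hF.arr 1 (by decide)] at this
  exact this

end

end Merge

/-! ### Testing, minimising, recording and printing one candidate -/

namespace Merge
open Macro RAM

/-- Copy row `var 34` of array `5` to array `1`. -/
def loadRow : Cmd := .rep 27 0 (.put 1 (.var 27) (.get 5 (.add (.var 34) (.var 27))))

/-- Put the membership of vertex `var 20` in the extended set into array `3`. -/
def lightBody : Cmd :=
  .seq (.set 21 (.get 1 (.var 20))) <| .seq (.put 1 (.var 20) (.lit 1)) <| .seq defiCmd <|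
  .seq (.put 1 (.var 20) (.var 21)) <|
  .ite (.add (.var 21) (.sub (.sub (.var 22) (.lit 1))
      (.add (.sub (.var 22) (.var 16)) (.sub (.var 22) (.var 16)))))
    (.put 3 (.var 20) (.lit 1)) (.put 3 (.var 20) (.lit 0))

/-- Copy array `3` to array `1`. -/
def copyBack : Cmd := .rep 27 0 (.put 1 (.var 27) (.get 3 (.var 27)))

/-- Load a set into array `1` and add its light vertices. -/
def lightCmd : Cmd :=
  .seq loadRow <| .seq defiCmd <| .seq (.set 22 (.var 16)) <| .seq (.rep 20 0 lightBody) copyBack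

/-- Set `var 26` to zero if row `var 24` of array `4` is not contained in array `1`. -/
def subsetCmd : Cmd :=
  .seq (.set 26 (.lit 1)) <|
  .rep 27 0 (.ite (.get 4 (.add (.var 24) (.var 27)))
    (.ite (.get 1 (.var 27)) .skip (.set 26 (.lit 0))) .skip)

/-- Set `var 23` to one if some recorded set is contained in array `1`. -/
def checkCmd : Cmd :=
  .seq (.set 23 (.lit 0)) <| .seq (.set 24 (.lit 0)) <|
  .rep 25 4 (.seq subsetCmd (.seq (.ite (.var 26) (.set 23 (.lit 1)) .skip)
    (.set 24 (.add (.var 24) (.var 0)))))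

/-- Remove vertex `var 20` from array `1` if this keeps the deficiency at one. -/
def dropBody : Cmd :=
  .seq (.set 21 (.get 1 (.var 20))) <| .seq (.put 1 (.var 20) (.lit 0)) <| .seq defiCmd <|
  .ite (.sub (.var 16) (.lit 1)) (.put 1 (.var 20) (.var 21)) .skip

/-- Greedily minimise the set in array `1`. -/
def minimiseCmd : Cmd := .rep 20 0 dropBody

/-- Copy array `1` to row `var 37` of array `4`. -/
def recordCmd : Cmd := .rep 27 0 (.put 4 (.add (.var 37) (.var 27)) (.get 1 (.var 27)))

/-- Output the set in array `1`. -/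
def outputCmd : Cmd :=
  .seq (.rep 27 0 (.ite (.get 1 (.var 27)) (.wr (.add (.var 27) (.lit 1))) .skip)) (.wr (.lit 0))

/-- Test a candidate; if it leads to a new solution, record and output that solution. -/
def processCmd : Cmd :=
  .ite (.var 8) .skip <| .seq lightCmd <| .seq defiCmd <|
  .ite (.sub (.var 16) (.lit 1)) .skip <| .seq checkCmd <|
  .ite (.var 23) .skip <| .seq minimiseCmd <| .seq recordCmd <| .seq outputCmd (.set 8 (.lit 1))

section

variable {n : ℕ} {inp : ℕ → ℕ}

/-- Loop rule for a loop that fills a segment of an array. -/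
theorem fill_rule {B : ℕ} {x y : ℕ} {c : Cmd} {σ : Env} (a : Fin 8) (o : ℕ) (f : ℕ → ℕ)
    (h : ∀ i < σ.var y, ∀ τ, Frame (.rep x y c) σ τ → τ.var x = i →
      (∀ j, j < o ∨ o + i ≤ j → τ.arr a j = σ.arr a j) →
      ∀ j, (c.run B inp τ).arr a j = if j = o + i then f i else τ.arr a j) (j : ℕ) :
    ((Cmd.rep x y c).run B inp σ).arr a j =
      if o ≤ j ∧ j < o + σ.var y then f (j - o) else σ.arr a j := by
  refine Cmd.for_rule (B := B) (inp := inp) (x := x) (y := y) (c := c) (σ := σ)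
    (fun i τ => ∀ j, τ.arr a j = if o ≤ j ∧ j < o + i then f (j - o) else σ.arr a j)
    (fun j => by rw [if_neg (by omega)]) (fun i hi τ hF hx hI j => ?_) (fun i τ v h => h) j
  rw [h i hi τ hF hx (fun j hj => by rw [hI, if_neg (by omega)])]
  by_cases hj : j = o + i
  · rw [if_pos hj, if_pos (by omega)]; congr 1; omega
  · rw [if_neg hj, hI]
    have : (o ≤ j ∧ j < o + (i + 1)) ↔ (o ≤ j ∧ j < o + i) := by omega
    simp only [this]

theorem toSet_congr {z z' : ℕ → ℕ} (h : ∀ v < n, z v = z' v) : toSet n z = toSet n z' := by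
  ext v; rw [mem_toSet, mem_toSet, h v v.2]

theorem run_defiCmd' {σ : Env} (hT : Tables n inp σ) :
    (defiCmd.run (n * n) inp σ).var 16 = defi inp (toSet n (σ.arr 1)) := by
  rw [run_defiCmd hT, defi_toSet]

theorem run_loadRow {σ : Env} (hT : Tables n inp σ) :
    toSet n ((loadRow.run (n * n) inp σ).arr 1) = toSet n fun v => σ.arr 5 (σ.var 34 + v) := by
  refine toSet_congr fun v hv => ?_
  rw [loadRow, fill_rule 1 0 (fun v => σ.arr 5 (σ.var 34 + v)) (fun i hi τ hF hx hj j => ?_) v]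
  · rw [hT.size]; simp [hv]
  · simp [Cmd.run, Ex.eval, Env.put_arr, hx, hF.var 34 (by decide), hF.arr 5 (by decide)]

theorem run_copyBack {σ : Env} (hT : Tables n inp σ) :
    toSet n ((copyBack.run (n * n) inp σ).arr 1) = toSet n (σ.arr 3) := by
  refine toSet_congr fun v hv => ?_
  rw [copyBack, fill_rule 1 0 (σ.arr 3) (fun i hi τ hF hx hj j => ?_) v]
  · rw [hT.size]; simp [hv]
  · simp [Cmd.run, Ex.eval, Env.put_arr, hx, hF.arr 3 (by decide)]

theorem Tables.put {σ : Env} (h : Tables n inp σ) {a : Fin 8} (ha : a ≠ 0) (i v : ℕ) :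
    Tables n inp (σ.put a i v) :=
  h.of_eq rfl rfl rfl (by funext j; rw [Env.put_arr, if_neg (by simp [ha.symm])])

/-- The vertex is inserted on trial and its old bit restored from variable `21`. The tested sum is
nonzero if that bit is set or if twice the drop in deficiency is below the excess. The answer goes
to array `3`, so later vertices are still tested against the original set. -/
theorem run_lightBody {τ : Env} (hT : Tables n inp τ) {i : ℕ} (hi : i < n) (hx : τ.var 20 = i)
    (h22 : τ.var 22 = defi inp (toSet n (τ.arr 1))) :
    (lightBody.run (n * n) inp τ).arr 1 = τ.arr 1 ∧
    (∀ j, j ≠ i → (lightBody.run (n * n) inp τ).arr 3 j = τ.arr 3 j) ∧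
    ((lightBody.run (n * n) inp τ).arr 3 i ≠ 0 ↔
      (⟨i, hi⟩ : Fin n) ∈ toSet n (τ.arr 1) ∪ light inp (toSet n (τ.arr 1))) := by
  set τ1 := (τ.set 21 (τ.arr 1 i)).put 1 i 1 with hτ1
  have hT1 : Tables n inp τ1 := (hT.set (by norm_num) _).put (by decide) _ _
  have hF := defiCmd.frame (n * n) inp τ1
  have hg := run_defiCmd' hT1
  have e20 : (defiCmd.run (n * n) inp τ1).var 20 = i := by
    rw [hF.var 20 (by decide)]; simp [hτ1, Env.set_var, hx]
  have e21 : (defiCmd.run (n * n) inp τ1).var 21 = τ.arr 1 i := by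
    rw [hF.var 21 (by decide)]; simp [hτ1, Env.set_var]
  have e22 : (defiCmd.run (n * n) inp τ1).var 22 = τ.var 22 := by
    rw [hF.var 22 (by decide)]; simp [hτ1, Env.set_var]
  have f1 : ∀ j, (defiCmd.run (n * n) inp τ1).arr 1 j = if j = i then 1 else τ.arr 1 j := by
    intro j; rw [hF.arr 1 (by decide)]; simp [hτ1, Env.put_arr]
  have f3 : ∀ j, (defiCmd.run (n * n) inp τ1).arr 3 j = τ.arr 3 j := by
    intro j; rw [hF.arr 3 (by decide)]; simp [hτ1, Env.put_arr]
  have hs : toSet n (τ1.arr 1) = insert ⟨i, hi⟩ (toSet n (τ.arr 1)) := by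
    ext v
    simp only [hτ1, mem_toSet, Env.put_arr, Finset.mem_insert, Fin.ext_iff, Env.set_arr, true_and]
    split_ifs with h <;> simp [h]
  rw [hs] at hg
  have hrun : lightBody.run (n * n) inp τ = if τ.arr 1 i + (τ.var 22 - 1 -
      ((τ.var 22 - defi inp (insert ⟨i, hi⟩ (toSet n (τ.arr 1)))) +
       (τ.var 22 - defi inp (insert ⟨i, hi⟩ (toSet n (τ.arr 1)))))) ≠ 0 then
      ((defiCmd.run (n * n) inp τ1).put 1 i (τ.arr 1 i)).put 3 i 1 else
      ((defiCmd.run (n * n) inp τ1).put 1 i (τ.arr 1 i)).put 3 i 0 := by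
    simp only [lightBody, Cmd.run, Ex.eval, Env.set_var, Env.put_var, hx,
      if_neg (show ¬ (20 : ℕ) = 21 by norm_num)]
    simp only [← hτ1, e20, e21, e22, hg]
  refine ⟨?_, ?_, ?_⟩
  · have key : ∀ v, (((defiCmd.run (n * n) inp τ1).put 1 i (τ.arr 1 i)).put 3 i v).arr 1 = τ.arr 1 := by
      intro v
      funext j
      simp only [Env.put_arr, f1]
      by_cases hj : j = i <;> simp [hj]
    rw [hrun]; split_ifs <;> exact key _
  · intro j hj
    rw [hrun]
    split_ifs <;> simp [Env.put_arr, hj, f3]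
  · rw [hrun, Finset.mem_union, mem_toSet, light, Finset.mem_filter]
    simp only [Finset.mem_univ, true_and, ← h22]
    split_ifs with h
    · simp only [Env.put_arr, true_and, if_true]
      constructor
      · intro _; omega
      · intro _; norm_num
    · simp only [Env.put_arr, true_and, if_true]
      constructor
      · intro h; exact absurd rfl h
      · intro h; omega

theorem run_lightCmd {σ : Env} (hT : Tables n inp σ) {Z : Finset (Fin n)}
    (hZ : toSet n (fun v => σ.arr 5 (σ.var 34 + v)) = Z) :
    toSet n ((lightCmd.run (n * n) inp σ).arr 1) = Z ∪ light inp Z := by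
  set σ1 := loadRow.run (n * n) inp σ with h1
  have hT1 : Tables n inp σ1 := hT.frame (loadRow.frame _ _ _) (by decide)
  set σ2 := defiCmd.run (n * n) inp σ1 with h2
  have hF2 := defiCmd.frame (n * n) inp σ1
  have hT2 : Tables n inp σ2 := hT1.frame hF2 (by decide)
  set σ3 := σ2.set 22 (σ2.var 16) with h3
  have hT3 : Tables n inp σ3 := hT2.set (by norm_num) _
  have hs : toSet n (σ3.arr 1) = Z := by
    rw [h3, Env.set_arr, h2, hF2.arr 1 (by decide), h1, run_loadRow hT, hZ]
  have h22 : σ3.var 22 = defi inp Z := by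
    rw [h3, Env.set_var, if_pos rfl, h2, run_defiCmd' hT1, h1, run_loadRow hT, hZ]
  have hloop := Cmd.for_rule (B := n * n) (inp := inp) (x := 20) (y := 0) (c := lightBody) (σ := σ3)
    (fun i τ => τ.arr 1 = σ3.arr 1 ∧ ∀ v (hv : v < n), v < i →
      (τ.arr 3 v ≠ 0 ↔ (⟨v, hv⟩ : Fin n) ∈ Z ∪ light inp Z))
    ⟨rfl, by simp⟩ (fun i hi τ hF hx hI => by
      rw [hT3.size] at hi
      have := run_lightBody (hT3.frame hF (by decide)) hi hx
        (by rw [hF.var 22 (by decide), h22, hI.1, hs])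
      rw [hI.1, hs] at this
      refine ⟨this.1, fun v hv hvi => ?_⟩
      by_cases hvi' : v = i
      · subst hvi'; exact this.2.2
      · rw [this.2.1 v hvi']; exact hI.2 v hv (by omega)) (fun i τ v h => h)
  rw [hT3.size] at hloop
  have hT4 : Tables n inp ((Cmd.rep 20 0 lightBody).run (n * n) inp σ3) :=
    hT3.frame (Cmd.frame _ _ _ _) (by decide)
  change toSet n ((copyBack.run (n * n) inp ((Cmd.rep 20 0 lightBody).run (n * n) inp σ3)).arr 1) = _
  rw [run_copyBack hT4]
  ext v
  rw [mem_toSet, hloop.2 v v.2 v.2]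

theorem run_subsetCmd {σ : Env} (hT : Tables n inp σ) :
    (subsetCmd.run (n * n) inp σ).var 26 ≠ 0 ↔
      toSet n (fun v => σ.arr 4 (σ.var 24 + v)) ⊆ toSet n (σ.arr 1) := by
  have := Cmd.for_rule (B := n * n) (inp := inp) (x := 27) (y := 0)
    (c := .ite (.get 4 (.add (.var 24) (.var 27)))
    (.ite (.get 1 (.var 27)) .skip (.set 26 (.lit 0))) .skip) (σ := σ.set 26 1)
    (fun i τ => τ.var 26 ≠ 0 ↔ ∀ v < i, σ.arr 4 (σ.var 24 + v) ≠ 0 → σ.arr 1 v ≠ 0)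
    (by simp [Env.set_var]) (fun i hi τ hF hx hI => by
      have e : (∀ v < i + 1, σ.arr 4 (σ.var 24 + v) ≠ 0 → σ.arr 1 v ≠ 0) ↔
          (∀ v < i, σ.arr 4 (σ.var 24 + v) ≠ 0 → σ.arr 1 v ≠ 0) ∧
            (σ.arr 4 (σ.var 24 + i) ≠ 0 → σ.arr 1 i ≠ 0) :=
        Nat.forall_lt_succ_right
      rw [e, ← hI]
      have e1 := hF.var 24 (by decide)
      have e2 := hF.arr 4 (by decide)
      have e3 := hF.arr 1 (by decide)
      norm_num [Env.set_var] at e1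
      simp only [Cmd.run, Ex.eval, hx, e1, e2, e3, Env.set_arr]
      split_ifs with h1 h2
      · simp [h2]
      · simp [Env.set_var, h1, h2]
      · simp [h1]) (fun i τ v h => by simpa [Env.set_var] using h)
  change (Cmd.run (n * n) inp _ (σ.set 26 1)).var 26 ≠ 0 ↔ _
  rw [this, show (σ.set 26 1).var 0 = n by simpa [Env.set_var] using hT.size]
  constructor
  · intro h v hv
    rw [mem_toSet] at hv ⊢
    exact h v v.2 hv
  · intro h v hv h1
    exact mem_toSet.1 (h ((mem_toSet (v := ⟨v, hv⟩)).2 h1))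

/-- The sets recorded in the rows of an array. -/
def rowSet (n : ℕ) (A : ℕ → ℕ) (h : ℕ) : Finset (Fin n) := toSet n fun v => A (h * n + v)

theorem run_checkCmd {σ : Env} (hT : Tables n inp σ) :
    (checkCmd.run (n * n) inp σ).var 23 = 0 ↔
      ∀ h < σ.var 4, ¬ rowSet n (σ.arr 4) h ⊆ toSet n (σ.arr 1) := by
  have := Cmd.for_rule (B := n * n) (inp := inp) (x := 25) (y := 4)
    (c := .seq subsetCmd (.seq (.ite (.var 26) (.set 23 (.lit 1)) .skip)
      (.set 24 (.add (.var 24) (.var 0))))) (σ := (σ.set 23 0).set 24 0)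
    (fun i τ => τ.var 24 = i * n ∧ (τ.var 23 = 0 ↔
      ∀ h < i, ¬ rowSet n (σ.arr 4) h ⊆ toSet n (σ.arr 1)))
    (by simp [Env.set_var]) (fun i hi τ hF hx hI => by
      have e : (∀ h < i + 1, ¬ rowSet n (σ.arr 4) h ⊆ toSet n (σ.arr 1)) ↔
          (∀ h < i, ¬ rowSet n (σ.arr 4) h ⊆ toSet n (σ.arr 1)) ∧
            ¬ rowSet n (σ.arr 4) i ⊆ toSet n (σ.arr 1) :=
        Nat.forall_lt_succ_right
      rw [e, ← hI.2]
      have tT : Tables n inp τ :=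
        ((hT.set (by norm_num) _).set (by norm_num) _).frame hF (by decide)
      have hs := run_subsetCmd tT
      have hF1 := subsetCmd.frame (n * n) inp τ
      have e1 := hF1.var 24 (by decide)
      have e2 := hF1.var 0 (by decide)
      have e3 := hF1.var 23 (by decide)
      rw [hI.1, hF.arr 4 (by decide), hF.arr 1 (by decide)] at hs
      change _ ↔ rowSet n (σ.arr 4) i ⊆ toSet n (σ.arr 1) at hs
      rw [← hs]
      simp only [Cmd.run, Ex.eval]
      split_ifs with h1
      · norm_num [Env.set_var, h1, e1, e2, tT.size, hI.1]; ring
      · norm_num [Env.set_var, h1, e1, e2, e3, tT.size, hI.1]; ring)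
    (fun i τ v h => by simpa [Env.set_var] using h)
  change (Cmd.run (n * n) inp _ ((σ.set 23 0).set 24 0)).var 23 = 0 ↔ _
  rw [this.2]
  rfl

theorem run_dropBody {τ : Env} (hT : Tables n inp τ) {i : ℕ} (hi : i < n) (hx : τ.var 20 = i)
    (hD : (darts n inp).Nonempty) :
    (defi inp ((toSet n (τ.arr 1)).erase ⟨i, hi⟩) = 1 ∧
      toSet n ((dropBody.run (n * n) inp τ).arr 1) = (toSet n (τ.arr 1)).erase ⟨i, hi⟩) ∨
    (defi inp ((toSet n (τ.arr 1)).erase ⟨i, hi⟩) ≠ 1 ∧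
      toSet n ((dropBody.run (n * n) inp τ).arr 1) = toSet n (τ.arr 1)) := by
  set τ1 := (τ.set 21 (τ.arr 1 i)).put 1 i 0 with hτ1
  have hT1 : Tables n inp τ1 := (hT.set (by norm_num) _).put (by decide) _ _
  have hF := defiCmd.frame (n * n) inp τ1
  have hg := run_defiCmd' hT1
  have e20 : (defiCmd.run (n * n) inp τ1).var 20 = i := by
    rw [hF.var 20 (by decide)]; simp [hτ1, Env.set_var, hx]
  have e21 : (defiCmd.run (n * n) inp τ1).var 21 = τ.arr 1 i := by
    rw [hF.var 21 (by decide)]; simp [hτ1, Env.set_var]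
  have f1 := hF.arr 1 (by decide)
  have hs : toSet n (τ1.arr 1) = (toSet n (τ.arr 1)).erase ⟨i, hi⟩ := by
    ext v
    simp only [hτ1, mem_toSet, Env.put_arr, Finset.mem_erase, ne_eq, Fin.ext_iff, Env.set_arr,
      true_and]
    split_ifs with h <;> simp [h]
  rw [hs] at hg
  have hpos : 1 ≤ defi inp ((toSet n (τ.arr 1)).erase ⟨i, hi⟩) := deficiency_pos hD _
  have hrun : dropBody.run (n * n) inp τ =
      if defi inp ((toSet n (τ.arr 1)).erase ⟨i, hi⟩) - 1 ≠ 0 then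
      (defiCmd.run (n * n) inp τ1).put 1 i (τ.arr 1 i) else defiCmd.run (n * n) inp τ1 := by
    simp only [dropBody, Cmd.run, Ex.eval, Env.set_var, hx,
      if_neg (show ¬ (20 : ℕ) = 21 by norm_num)]
    simp only [← hτ1, e20, e21, hg]
  by_cases h : defi inp ((toSet n (τ.arr 1)).erase ⟨i, hi⟩) = 1
  · refine .inl ⟨h, ?_⟩
    rw [hrun, if_neg (by omega), f1, hs]
  · refine .inr ⟨h, toSet_congr fun v _ => ?_⟩
    rw [hrun, if_pos (by omega), Env.put_arr, f1, hτ1, Env.put_arr]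
    by_cases hv : v = i <;> simp [hv]

/-- One pass suffices: by monotonicity, a vertex that could not be dropped earlier cannot be dropped
from the smaller set at the end. For the same reason, failure of all single deletions is already
minimality. -/
theorem run_minimiseCmd {σ : Env} (hT : Tables n inp σ) (hD : (darts n inp).Nonempty)
    (h1 : defi inp (toSet n (σ.arr 1)) = 1) :
    toSet n ((minimiseCmd.run (n * n) inp σ).arr 1) ⊆ toSet n (σ.arr 1) ∧
    Minimal (fun Z : Finset (Fin n) => defi inp Z = 1)
      (toSet n ((minimiseCmd.run (n * n) inp σ).arr 1)) := by
  have pos : ∀ Z : Finset (Fin n), 1 ≤ defi inp Z := fun Z => deficiency_pos hD _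
  have := Cmd.for_rule (B := n * n) (inp := inp) (x := 20) (y := 0) (c := dropBody) (σ := σ)
    (fun i τ => toSet n (τ.arr 1) ⊆ toSet n (σ.arr 1) ∧ defi inp (toSet n (τ.arr 1)) = 1 ∧
      ∀ v : Fin n, v < i → v ∈ toSet n (τ.arr 1) → defi inp ((toSet n (τ.arr 1)).erase v) ≠ 1)
    ⟨subset_rfl, h1, by simp⟩ (fun i hi τ hF hx hI => by
      rw [hT.size] at hi
      obtain ⟨hs, hd, hm⟩ := hI
      rcases run_dropBody (hT.frame hF (by decide)) hi hx hD with ⟨h, e⟩ | ⟨h, e⟩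
      · rw [e]
        refine ⟨(Finset.erase_subset _ _).trans hs, h, fun v hv hvm hc => ?_⟩
        have hne := Finset.ne_of_mem_erase hvm
        have hvi : (v : ℕ) ≠ i := fun h => hne (Fin.ext h)
        refine hm v (by omega) (Finset.mem_of_mem_erase hvm) (le_antisymm ?_ (pos _))
        rw [← hc]
        exact defi_anti (Finset.erase_subset_erase _ (Finset.erase_subset _ _))
      · rw [e]
        refine ⟨hs, hd, fun v hv hvm => ?_⟩
        by_cases hvi : (v : ℕ) = i
        · have : v = ⟨i, hi⟩ := Fin.ext hvi
          rw [this]; exact h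
        · exact hm v (by omega) hvm) (fun i τ v h => h)
  rw [hT.size] at this
  refine ⟨this.1, this.2.1, fun Z hZ hs => ?_⟩
  intro v hv
  by_contra hc
  refine this.2.2 v v.2 hv (le_antisymm ?_ (pos _))
  rw [← hZ]
  exact defi_anti fun w hw => Finset.mem_erase.2 ⟨fun h => hc (h ▸ hw), hs hw⟩

theorem run_recordCmd {σ : Env} (hT : Tables n inp σ) (j : ℕ) :
    (recordCmd.run (n * n) inp σ).arr 4 j =
      if σ.var 37 ≤ j ∧ j < σ.var 37 + n then σ.arr 1 (j - σ.var 37) else σ.arr 4 j := by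
  rw [recordCmd, fill_rule 4 (σ.var 37) (σ.arr 1) (fun i hi τ hF hx hj j => ?_) j, hT.size]
  simp [Cmd.run, Ex.eval, Env.put_arr, hx, hF.var 37 (by decide), hF.arr 1 (by decide)]

theorem encodeSet_toSet (z : ℕ → ℕ) : encodeSet (toSet n z) =
    (((List.range n).filter fun v => z v ≠ 0).map fun v => v + 1) ++ [0] := by
  -- The coercion of vertices in `encodeSet` is elaborated as a monadic bind on the list.
  have lift : ∀ l : List (Fin n), (l >>= fun a => pure (a : ℕ)) = l.map Fin.val :=
    fun l => List.flatMap_pure_eq_map _ _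
  rw [encodeSet, lift, ← List.map_coe_finRange_eq_range, List.filter_map]
  simp only [Function.comp_def, mem_toSet]

theorem run_outputCmd {σ : Env} (hT : Tables n inp σ) :
    (outputCmd.run (n * n) inp σ).out = σ.out ++ encodeSet (toSet n (σ.arr 1)) := by
  have := Cmd.for_rule (B := n * n) (inp := inp) (x := 27) (y := 0)
    (c := .ite (.get 1 (.var 27)) (.wr (.add (.var 27) (.lit 1))) .skip) (σ := σ)
    (fun i τ => τ.out = σ.out ++ ((List.range i).filter fun v => σ.arr 1 v ≠ 0).map fun v => v + 1)
    (by simp) (fun i hi τ hF hx hI => by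
      rw [List.range_succ, List.filter_append, List.map_append]
      simp only [Cmd.run, Ex.eval, hx, hF.arr 1 (by decide)]
      split_ifs with h
      · simp [hI, h]
      · simp [hI, not_not.1 h]) (fun i τ v h => h)
  rw [hT.size] at this
  simp only [outputCmd, Cmd.run, Ex.eval] at this ⊢
  rw [this, encodeSet_toSet]
  simp

end

end Merge

/-! ### Generating the unions of pieces row by row -/

namespace Merge
open Macro RAM

/-- Write the union of a row and a piece into the next free row of array `5`. -/
def buildCmd : Cmd :=
  .rep 27 0 <| .seq
    (.ite (.sub (.var 4) (.var 31))
      (.ite (dist (.var 27) (.var 33)) (.set 36 (.get 4 (.add (.var 32) (.var 27))))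
        (.set 36 (.lit 0)))
      (.ite (dist (.var 27) (.var 33)) (.set 36 (.lit 0)) (.set 36 (.lit 1))))
    (.put 5 (.add (.add (.var 34) (.var 0)) (.var 27))
      (.add (.get 5 (.add (.var 30) (.var 27))) (.var 36)))

/-- Advance the counters that describe the next row to build. -/
def advanceCmd : Cmd :=
  .seq (.set 33 (.add (.var 33) (.lit 1))) <|
  .seq (.ite (.sub (.var 0) (.var 33)) .skip <|
    .seq (.set 33 (.lit 0)) <| .seq (.set 31 (.add (.var 31) (.lit 1))) <|
    .seq (.set 32 (.add (.var 32) (.var 0))) <|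
    .ite (.sub (.add (.var 4) (.lit 1)) (.var 31)) .skip <|
    .seq (.set 31 (.lit 0)) <| .seq (.set 32 (.lit 0)) (.set 30 (.add (.var 30) (.var 0)))) <|
  .set 34 (.add (.var 34) (.var 0))

/-- Test all candidates. -/
def scanCmd : Cmd := .rep 35 7 (.seq processCmd (.seq buildCmd advanceCmd))

/-- Compute the number of rows to scan from the number of pieces. -/
def powerCmd : Cmd :=
  .rep 38 3 (.seq (.set 39 (.lit 0)) <|
    .seq (.rep 40 6 (.set 39 (.add (.var 39) (.var 7)))) (.set 7 (.var 39)))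

/-- Compute the number of pieces. -/
def countCmd : Cmd :=
  .seq (.set 5 (.add (.var 4) (.lit 1))) <| .seq (.set 6 (.lit 1)) <|
  .rep 38 5 (.set 6 (.add (.var 6) (.var 0)))

/-- Initialise the counters. -/
def resetCmd : Cmd :=
  .seq (.rep 27 0 (.put 5 (.var 27) (.lit 0))) <|
  .seq (.set 30 (.lit 0)) <| .seq (.set 31 (.lit 0)) <| .seq (.set 32 (.lit 0)) <|
  .seq (.set 33 (.lit 0)) <| .seq (.set 34 (.lit 0)) (.set 8 (.lit 0))

/-- Register a new solution. -/
def finishCmd : Cmd :=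
  .ite (.var 8) (.seq (.set 4 (.add (.var 4) (.lit 1))) (.set 37 (.add (.var 37) (.var 0)))) .skip

/-- Preparation of a round. -/
def prepareCmd : Cmd := .seq countCmd <| .seq (.set 7 (.lit 1)) <| .seq powerCmd resetCmd

/-- Look for one new solution. -/
def roundCmd : Cmd := .seq prepareCmd <| .seq scanCmd finishCmd

section

variable {n : ℕ} {inp : ℕ → ℕ}

/-- A set leads to a new solution: it becomes feasible by adding its light vertices, and then
contains none of the first `b` recorded sets. -/
def Good (inp : ℕ → ℕ) (A : ℕ → ℕ) (b : ℕ) (Z : Finset (Fin n)) : Prop :=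
  defi inp (Z ∪ light inp Z) = 1 ∧ ∀ h < b, ¬ rowSet n A h ⊆ Z ∪ light inp Z

/-- A new minimal solution has been found, recorded and output. -/
def Found (n : ℕ) (inp : ℕ → ℕ) (b : ℕ) (σ τ : Env) : Prop :=
  τ.var 8 = 1 ∧ ∃ C : Finset (Fin n), Minimal (fun Z : Finset (Fin n) => defi inp Z = 1) C ∧
    (∀ h < b, ¬ rowSet n (σ.arr 4) h ⊆ C) ∧ τ.out = σ.out ++ encodeSet C ∧
    rowSet n (τ.arr 4) b = C ∧ ∀ h < b, rowSet n (τ.arr 4) h = rowSet n (σ.arr 4) h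

theorem row_lt {h b v : ℕ} (hh : h < b) (hv : v < n) : h * n + v < b * n := by nlinarith

/-- A solution minimised inside a set that contains no recorded solution contains none either, so it
is new. Recording writes only the first free row and leaves earlier rows intact. -/
theorem run_processCmd {σ : Env} (hT : Tables n inp σ) (hD : (darts n inp).Nonempty) {k : ℕ}
    (h8 : σ.var 8 = 0) (h34 : σ.var 34 = k * n) (h37 : σ.var 37 = σ.var 4 * n) :
    ((processCmd.run (n * n) inp σ).var 8 = 0 ∧
      (processCmd.run (n * n) inp σ).arr 4 = σ.arr 4 ∧
      (processCmd.run (n * n) inp σ).out = σ.out ∧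
      ¬ Good inp (σ.arr 4) (σ.var 4) (rowSet n (σ.arr 5) k)) ∨
    Found n inp (σ.var 4) σ (processCmd.run (n * n) inp σ) := by
  set Z := rowSet n (σ.arr 5) k with hZ
  obtain ⟨σ1, h1⟩ : ∃ τ, lightCmd.run (n * n) inp σ = τ := ⟨_, rfl⟩
  have F1 : Frame lightCmd σ σ1 := h1 ▸ lightCmd.frame _ _ _
  have T1 : Tables n inp σ1 := hT.frame F1 (by decide)
  have s1 : toSet n (σ1.arr 1) = Z ∪ light inp Z := by
    rw [← h1]; exact run_lightCmd hT (by rw [h34]; rfl)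
  obtain ⟨σ2, h2⟩ : ∃ τ, defiCmd.run (n * n) inp σ1 = τ := ⟨_, rfl⟩
  have F2 : Frame defiCmd σ1 σ2 := h2 ▸ defiCmd.frame _ _ _
  have T2 : Tables n inp σ2 := T1.frame F2 (by decide)
  have d2 : σ2.var 16 = defi inp (Z ∪ light inp Z) := by rw [← h2, run_defiCmd' T1, s1]
  have s2 : toSet n (σ2.arr 1) = Z ∪ light inp Z := by rw [F2.arr 1 (by decide), s1]
  obtain ⟨σ3, h3⟩ : ∃ τ, checkCmd.run (n * n) inp σ2 = τ := ⟨_, rfl⟩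
  have F3 : Frame checkCmd σ2 σ3 := h3 ▸ checkCmd.frame _ _ _
  have T3 : Tables n inp σ3 := T2.frame F3 (by decide)
  have a2 : σ2.arr 4 = σ.arr 4 := by rw [F2.arr 4 (by decide), F1.arr 4 (by decide)]
  have b2 : σ2.var 4 = σ.var 4 := by rw [F2.var 4 (by decide), F1.var 4 (by decide)]
  have c3 := run_checkCmd T2
  rw [a2, b2, s2, h3] at c3
  have s3 : toSet n (σ3.arr 1) = Z ∪ light inp Z := by rw [F3.arr 1 (by decide), s2]
  have hpos : 1 ≤ defi inp (Z ∪ light inp Z) := deficiency_pos hD _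
  have v2 : σ2.var 8 = 0 := by rw [F2.var 8 (by decide), F1.var 8 (by decide), h8]
  have o2 : σ2.out = σ.out := by rw [F2.out (by decide), F1.out (by decide)]
  have hrun : processCmd.run (n * n) inp σ = if defi inp (Z ∪ light inp Z) - 1 ≠ 0 then σ2 else
      if σ3.var 23 ≠ 0 then σ3 else
      (outputCmd.run (n * n) inp (recordCmd.run (n * n) inp
        (minimiseCmd.run (n * n) inp σ3))).set 8 1 := by
    rw [← d2]
    simp only [processCmd, Cmd.run, Ex.eval, h8, h1, h2, h3]
    simp
  by_cases hd : defi inp (Z ∪ light inp Z) = 1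
  · by_cases hc : σ3.var 23 = 0
    · right
      rw [hrun, if_neg (by omega), if_neg (by omega)]
      obtain ⟨σ4, h4⟩ : ∃ τ, minimiseCmd.run (n * n) inp σ3 = τ := ⟨_, rfl⟩
      have F4 : Frame minimiseCmd σ3 σ4 := h4 ▸ minimiseCmd.frame _ _ _
      have T4 : Tables n inp σ4 := T3.frame F4 (by decide)
      obtain ⟨m1, m2⟩ := run_minimiseCmd T3 hD (by rw [s3, hd])
      rw [h4] at m1 m2
      rw [s3] at m1
      obtain ⟨σ5, h5⟩ : ∃ τ, recordCmd.run (n * n) inp σ4 = τ := ⟨_, rfl⟩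
      have F5 : Frame recordCmd σ4 σ5 := h5 ▸ recordCmd.frame _ _ _
      have T5 : Tables n inp σ5 := T4.frame F5 (by decide)
      obtain ⟨σ6, h6⟩ : ∃ τ, outputCmd.run (n * n) inp σ5 = τ := ⟨_, rfl⟩
      have F6 : Frame outputCmd σ5 σ6 := h6 ▸ outputCmd.frame _ _ _
      have a4 : σ4.arr 4 = σ.arr 4 := by rw [F4.arr 4 (by decide), F3.arr 4 (by decide), a2]
      have v4 : σ4.var 37 = σ.var 4 * n := by
        rw [F4.var 37 (by decide), F3.var 37 (by decide), F2.var 37 (by decide),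
          F1.var 37 (by decide), h37]
      have r5 := fun j => run_recordCmd T4 j
      simp only [h5, v4, a4] at r5
      rw [h4, h5, h6]
      refine ⟨by simp [Env.set_var], toSet n (σ4.arr 1), m2, fun h hh hs => c3.1 hc h hh (hs.trans m1),
        ?_, ?_, fun h hh => ?_⟩
      · rw [Env.set_out, ← h6, run_outputCmd T5, F5.arr 1 (by decide), F5.out (by decide),
          F4.out (by decide), F3.out (by decide), o2]
      · rw [Env.set_arr, F6.arr 4 (by decide)]
        refine toSet_congr fun v hv => ?_
        rw [r5, if_pos (by omega)]
        congr 1; omega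
      · rw [Env.set_arr, F6.arr 4 (by decide)]
        refine toSet_congr fun v hv => ?_
        have := row_lt hh hv
        rw [r5, if_neg (by omega)]
    · left
      rw [hrun, if_neg (by omega), if_pos hc]
      exact ⟨by rw [F3.var 8 (by decide), v2], by rw [F3.arr 4 (by decide), a2],
        by rw [F3.out (by decide), o2], fun hg => hc (c3.2 hg.2)⟩
  · left
    rw [hrun, if_pos (by omega)]
    exact ⟨v2, a2, o2, fun hg => hd hg.1⟩

/-- The piece with the given code: a recorded set less a vertex, or a single vertex. -/
def piece (n : ℕ) (A : ℕ → ℕ) (b h y : ℕ) : Finset (Fin n) :=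
  if h < b then (rowSet n A h).filter fun v => (v : ℕ) ≠ y else Finset.univ.filter fun v => (v : ℕ) = y

theorem run_buildCmd {σ : Env} (hT : Tables n inp σ) {q h k : ℕ} (hqk : q ≤ k)
    (h30 : σ.var 30 = q * n) (h31 : σ.var 31 = h) (h32 : σ.var 32 = h * n) (h34 : σ.var 34 = k * n) :
    (∀ k' ≤ k, rowSet n ((buildCmd.run (n * n) inp σ).arr 5) k' = rowSet n (σ.arr 5) k') ∧
    rowSet n ((buildCmd.run (n * n) inp σ).arr 5) (k + 1) =
      rowSet n (σ.arr 5) q ∪ piece n (σ.arr 4) (σ.var 4) h (σ.var 33) := by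
  -- Union is addition of the entries, since membership only asks for a nonzero value.
  set f : ℕ → ℕ := fun v => σ.arr 5 (q * n + v) + (if h < σ.var 4 then
    (if v ≠ σ.var 33 then σ.arr 4 (h * n + v) else 0) else (if v ≠ σ.var 33 then 0 else 1)) with hf
  have hqn : q * n ≤ k * n := Nat.mul_le_mul_right _ hqk
  have key : ∀ j, (buildCmd.run (n * n) inp σ).arr 5 j =
      if (k + 1) * n ≤ j ∧ j < (k + 1) * n + n then f (j - (k + 1) * n) else σ.arr 5 j := by
    intro j
    rw [buildCmd, fill_rule 5 ((k + 1) * n) f (fun i hi τ hF hx hj j => ?_) j, hT.size]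
    rw [hT.size] at hi
    have e0 := (hF.var 0 (by decide)).trans hT.size
    have e4 := hF.var 4 (by decide)
    have e30 := (hF.var 30 (by decide)).trans h30
    have e31 := (hF.var 31 (by decide)).trans h31
    have e32 := (hF.var 32 (by decide)).trans h32
    have e33 := hF.var 33 (by decide)
    have e34 := (hF.var 34 (by decide)).trans h34
    have f4 := hF.arr 4 (by decide)
    have f5 : τ.arr 5 (q * n + i) = σ.arr 5 (q * n + i) := hj _ (.inl (by rw [add_mul]; omega))
    have hb : σ.var 4 - h ≠ 0 ↔ h < σ.var 4 := by omega
    have ek : k * n + n = (k + 1) * n := by ring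
    simp only [Cmd.run, Ex.eval, eval_dist, e4, e31, e32, e33, hx, hb, hf, f4]
    split_ifs <;>
      simp [Env.put_arr, Env.set_var, *]
  constructor
  · intro k' hk'
    refine toSet_congr fun v hv => ?_
    have := row_lt (show k' < k + 1 by omega) hv
    rw [key, if_neg (by omega)]
  · ext v
    have hv := v.2
    rw [rowSet, mem_toSet, key, if_pos (by omega), Nat.add_sub_cancel_left, Finset.mem_union,
      rowSet, mem_toSet, piece]
    simp only [hf]
    split_ifs with h1 h2 h2
    · simp [h2, rowSet, mem_toSet]; tauto
    · simp [h2]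
    · simp [h2]
    · simp [not_not.1 h2]

end

end Merge

/-! ### Correctness of a scan and of a round -/

namespace Merge
open Macro RAM

section

variable {n : ℕ} {inp : ℕ → ℕ}

/-- The index of the row built from row `q` and the piece `(h, y)`, less one. -/
def code (n b q h y : ℕ) : ℕ := (q * (b + 1) + h) * n + y

/-- The counters at step `k` of the scan. -/
def Counters (n b k : ℕ) (τ : Env) (q h y : ℕ) : Prop :=
  y < n ∧ h ≤ b ∧ k = code n b q h y ∧ τ.var 30 = q * n ∧ τ.var 31 = h ∧ τ.var 32 = h * n ∧
    τ.var 33 = y ∧ τ.var 34 = k * n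

/-- An odometer with `y < n` as the fastest digit, then `h ≤ b`, then the parent row `q`. The
offsets are updated by addition because products are not available. -/
theorem run_advanceCmd {τ : Env} (h0 : τ.var 0 = n) {k q h y : ℕ}
    (hc : Counters n (τ.var 4) k τ q h y) :
    ∃ q' h' y', Counters n (τ.var 4) (k + 1) (advanceCmd.run (n * n) inp τ) q' h' y' := by
  obtain ⟨hy, hh, hk, e30, e31, e32, e33, e34⟩ := hc
  simp only [advanceCmd, Cmd.run, Ex.eval, Env.set_var]
  norm_num [e33, h0]
  by_cases c1 : n ≤ y + 1
  · rw [if_pos (by omega)]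
    obtain rfl : n = y + 1 := by omega
    norm_num [e31, Env.set_var]
    by_cases c2 : τ.var 4 ≤ h
    · rw [if_pos (by omega)]
      obtain rfl : h = τ.var 4 := by omega
      refine ⟨q + 1, 0, 0, ?_⟩
      norm_num [Counters, Env.set_var, e30, e34, h0, code, hk]
      refine ⟨?_, ?_, ?_⟩ <;> ring
    · rw [if_neg (by omega)]
      refine ⟨q, h + 1, 0, ?_⟩
      norm_num [Counters, Env.set_var, e30, e31, e32, e34, h0, code, hk]
      refine ⟨by omega, ?_, ?_, ?_⟩ <;> ring
  · rw [if_neg (by omega)]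
    refine ⟨q, h, y + 1, ?_⟩
    norm_num [Counters, Env.set_var, e30, e31, e32, e33, e34, h0, code, hk]
    refine ⟨by omega, by omega, ?_, ?_⟩ <;> ring

/-- The state of an unsuccessful scan after `k` steps, started in `σ`. -/
structure Scanning (n : ℕ) (inp : ℕ → ℕ) (σ : Env) (k : ℕ) (τ : Env) : Prop where
  counters : ∃ q h y, Counters n (σ.var 4) k τ q h y
  zero : rowSet n (τ.arr 5) 0 = ∅
  step : ∀ q h y, y < n → h ≤ σ.var 4 → code n (σ.var 4) q h y < k →
    rowSet n (τ.arr 5) (code n (σ.var 4) q h y + 1) =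
      rowSet n (τ.arr 5) q ∪ piece n (σ.arr 4) (σ.var 4) h y
  flag : τ.var 8 = 0
  same : τ.arr 4 = σ.arr 4
  out : τ.out = σ.out
  bad : ∀ i < k, ¬ Good inp (σ.arr 4) (σ.var 4) (rowSet n (τ.arr 5) i)

/-- A parent row precedes its children, so it has been written by the time it is read. -/
theorem le_code (hn : 0 < n) (b q h y : ℕ) : q ≤ code n b q h y := by
  unfold code
  calc q ≤ q * (b + 1) := Nat.le_mul_of_pos_right _ (by omega)
    _ ≤ q * (b + 1) + h := by omega
    _ ≤ (q * (b + 1) + h) * n := Nat.le_mul_of_pos_right _ hn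
    _ ≤ _ := by omega

theorem code_inj {b q h y q' h' y' : ℕ} (hy : y < n) (hy' : y' < n) (hh : h ≤ b) (hh' : h' ≤ b)
    (e : code n b q h y = code n b q' h' y') : q = q' ∧ h = h' ∧ y = y' := by
  obtain ⟨e1, rfl⟩ := cell_inj hy hy' e
  obtain ⟨rfl, rfl⟩ := cell_inj (n := b + 1) (by omega) (by omega) e1
  exact ⟨rfl, rfl, rfl⟩

/-- A counted loop cannot stop early. Once a solution is found, the flag in variable `8` turns
further tests into no-ops, and the rows still being built do not affect the recorded sets or the
output. -/
theorem run_scanCmd {σ : Env} (hT : Tables n inp σ) (hD : (darts n inp).Nonempty)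
    (h37 : σ.var 37 = σ.var 4 * n) (h0 : Scanning n inp σ 0 σ) :
    Scanning n inp σ (σ.var 7) (scanCmd.run (n * n) inp σ) ∨
      Found n inp (σ.var 4) σ (scanCmd.run (n * n) inp σ) := by
  refine Cmd.for_rule (B := n * n) (inp := inp) (x := 35) (y := 7)
    (c := .seq processCmd (.seq buildCmd advanceCmd)) (σ := σ)
    (fun k τ => Scanning n inp σ k τ ∨ Found n inp (σ.var 4) σ τ) (.inl h0)
    (fun k hk τ hF hx hI => ?_) (fun k τ v h => ?_)
  · have tT : Tables n inp τ := hT.frame hF (by decide)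
    obtain ⟨τ1, h1⟩ : ∃ τ1, processCmd.run (n * n) inp τ = τ1 := ⟨_, rfl⟩
    have F1 : Frame processCmd τ τ1 := h1 ▸ processCmd.frame _ _ _
    obtain ⟨τ2, h2⟩ : ∃ τ2, buildCmd.run (n * n) inp τ1 = τ2 := ⟨_, rfl⟩
    have F2 : Frame buildCmd τ1 τ2 := h2 ▸ buildCmd.frame _ _ _
    obtain ⟨τ3, h3⟩ : ∃ τ3, advanceCmd.run (n * n) inp τ2 = τ3 := ⟨_, rfl⟩
    have F3 : Frame advanceCmd τ2 τ3 := h3 ▸ advanceCmd.frame _ _ _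
    have hrun : Cmd.run (n * n) inp (.seq processCmd (.seq buildCmd advanceCmd)) τ = τ3 := by
      simp only [Cmd.run, h1, h2, h3]
    rw [hrun]
    have v4 : τ.var 4 = σ.var 4 := hF.var 4 (by decide)
    have fl : τ3.var 8 = τ1.var 8 := by rw [F3.var 8 (by decide), F2.var 8 (by decide)]
    have fa : τ3.arr 4 = τ1.arr 4 := by rw [F3.arr 4 (by decide), F2.arr 4 (by decide)]
    have fo : τ3.out = τ1.out := by rw [F3.out (by decide), F2.out (by decide)]
    have toFound : Found n inp (σ.var 4) σ τ1 → Found n inp (σ.var 4) σ τ3 := by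
      rintro ⟨a, C, b, c, d, e, f⟩
      exact ⟨fl.trans a, C, b, c, fo.trans d, fa ▸ e, fa ▸ f⟩
    rcases hI with hI | hI
    · obtain ⟨q, h, y, hc⟩ := hI.counters
      obtain ⟨hy, hh, hk', e30, e31, e32, e33, e34⟩ := hc
      have hp := run_processCmd tT hD hI.flag e34
        (by rw [hF.var 37 (by decide), h37, v4])
      rw [v4, h1, hI.same] at hp
      rcases hp with ⟨p8, p4, po, pb⟩ | ⟨a, C, b, c, d, e, f⟩
      · left
        have T1 : Tables n inp τ1 := tT.frame F1 (by decide)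
        have qk : q ≤ k := hk' ▸ le_code (by omega) _ _ _ _
        obtain ⟨r1, r2⟩ := run_buildCmd T1 qk ((F1.var 30 (by decide)).trans e30)
          ((F1.var 31 (by decide)).trans e31) ((F1.var 32 (by decide)).trans e32)
          ((F1.var 34 (by decide)).trans e34)
        rw [h2, ← F3.arr 5 (by decide), F1.arr 5 (by decide)] at r1 r2
        rw [p4, F1.var 4 (by decide), v4, F1.var 33 (by decide), e33] at r2
        refine ⟨?_, ?_, ?_, fl.trans p8, fa.trans p4, fo.trans (po.trans hI.out), ?_⟩
        · have c2 : Counters n (τ2.var 4) k τ2 q h y := by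
            refine ⟨hy, ?_, ?_, ?_, ?_, ?_, ?_, ?_⟩
            · rwa [F2.var 4 (by decide), F1.var 4 (by decide), v4]
            · rwa [F2.var 4 (by decide), F1.var 4 (by decide), v4]
            · rw [F2.var 30 (by decide), F1.var 30 (by decide), e30]
            · rw [F2.var 31 (by decide), F1.var 31 (by decide), e31]
            · rw [F2.var 32 (by decide), F1.var 32 (by decide), e32]
            · rw [F2.var 33 (by decide), F1.var 33 (by decide), e33]
            · rw [F2.var 34 (by decide), F1.var 34 (by decide), e34]
          have := run_advanceCmd (inp := inp) ((T1.frame F2 (by decide)).size) c2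
          rwa [F2.var 4 (by decide), F1.var 4 (by decide), v4, h3] at this
        · rw [r1 0 (by omega), hI.zero]
        · intro q' h' y' hy' hh' hlt
          rcases Nat.lt_succ_iff_lt_or_eq.1 hlt with hlt | heq
          · have := le_code (n := n) (by omega) (σ.var 4) q' h' y'
            rw [r1 _ (by omega), r1 _ (by omega)]
            exact hI.step q' h' y' hy' hh' hlt
          · rw [hk'] at heq
            obtain ⟨rfl, rfl, rfl⟩ := code_inj hy' hy hh' hh heq
            rw [← hk', r2, r1 _ qk]
        · intro i hi
          rw [r1 i (by omega)]
          rcases Nat.lt_succ_iff_lt_or_eq.1 hi with hlt | rfl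
          · exact hI.bad i hlt
          · exact pb
      · exact .inr (toFound ⟨a, C, b, hI.same ▸ c, by rw [d, hI.out], e, fun h hh => by
          rw [f h hh, hI.same]⟩)
    · refine .inr (toFound ?_)
      have : τ1 = τ := by
        rw [← h1]
        simp [processCmd, Cmd.run, Ex.eval, hI.1]
      rwa [this]
  · rcases h with h | h
    · refine .inl ⟨?_, h.zero, h.step, ?_, h.same, h.out, h.bad⟩
      · obtain ⟨q, c, y, hc⟩ := h.counters
        exact ⟨q, c, y, by simpa [Counters, Env.set_var] using hc⟩
      · simpa [Env.set_var] using h.flag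
    · exact .inr ⟨by simpa [Env.set_var] using h.1, h.2⟩

/-- Every short union of pieces occurs among the rows. -/
theorem Scanning.exists_row {σ τ : Env} {ℋ : List (Finset (Fin n))} (hℋ : ℋ.length = σ.var 4)
    (hrow : ∀ h (hh : h < ℋ.length), rowSet n (σ.arr 4) h = ℋ[h]) {e : ℕ}
    (hS : Scanning n inp σ (((σ.var 4 + 1) * n + 1) ^ e) τ) {d : ℕ} {Z : Finset (Fin n)}
    (hZ : Reach ℋ d Z) : d ≤ e →
    ∃ k, k + 1 ≤ ((σ.var 4 + 1) * n + 1) ^ d ∧ rowSet n (τ.arr 5) k = Z := by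
  set P := (σ.var 4 + 1) * n with hP
  -- The children of row `q` are the rows `q * P + 1` to `(q + 1) * P`, so one more piece multiplies
  -- the bound on the index by at most `P + 1`.
  have main : ∀ d q h y, d + 1 ≤ e → q + 1 ≤ (P + 1) ^ d → y < n → h ≤ σ.var 4 →
      code n (σ.var 4) q h y + 1 + 1 ≤ (P + 1) ^ (d + 1) ∧
      rowSet n (τ.arr 5) (code n (σ.var 4) q h y + 1) =
      rowSet n (τ.arr 5) q ∪ piece n (σ.arr 4) (σ.var 4) h y := by
    intro d q h y hd hq hy hh
    have h1 : code n (σ.var 4) q h y + 1 + 1 ≤ (P + 1) ^ (d + 1) := by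
      calc code n (σ.var 4) q h y + 1 + 1 ≤ (q * (σ.var 4 + 1) + σ.var 4) * n + n + 1 := by
            have := Nat.mul_le_mul_right n (Nat.add_le_add_left hh (q * (σ.var 4 + 1)))
            unfold code; omega
        _ = (q + 1) * P + 1 := by rw [hP]; ring
        _ ≤ (q + 1) * (P + 1) := by rw [mul_add]; omega
        _ ≤ _ := by rw [pow_succ]; exact Nat.mul_le_mul_right _ hq
    have h2 : (P + 1) ^ (d + 1) ≤ (P + 1) ^ e := Nat.pow_le_pow_right (by omega) hd
    exact ⟨h1, hS.step q h y hy hh (by omega)⟩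
  induction hZ with
  | nil => exact fun _ => ⟨0, by simp, hS.zero⟩
  | @vertex d Z y hZ ih =>
    intro hd
    obtain ⟨q, hq, rfl⟩ := ih (by omega)
    -- The code one past the recorded sets stands for a single vertex.
    obtain ⟨a, b⟩ := main d q (σ.var 4) y hd hq y.2 le_rfl
    refine ⟨_, a, ?_⟩
    rw [b, piece, if_neg (by omega)]
    ext v; simp [Fin.ext_iff, or_comm]
  | @erase d Z H y hZ hH ih =>
    intro hd
    obtain ⟨q, hq, rfl⟩ := ih (by omega)
    obtain ⟨h, hh, rfl⟩ := List.mem_iff_getElem.1 hH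
    obtain ⟨a, b⟩ := main d q h y hd hq y.2 (by omega)
    refine ⟨_, a, ?_⟩
    rw [b, piece, if_pos (by omega), hrow h hh]
    ext v; simp [Fin.ext_iff, and_comm]

theorem run_countCmd {σ : Env} : (countCmd.run (n * n) inp σ).var 5 = σ.var 4 + 1 ∧
    (countCmd.run (n * n) inp σ).var 6 = (σ.var 4 + 1) * σ.var 0 + 1 := by
  have := Cmd.for_rule (B := n * n) (inp := inp) (x := 38) (y := 5)
    (c := .set 6 (.add (.var 6) (.var 0))) (σ := (σ.set 5 (σ.var 4 + 1)).set 6 1)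
    (fun i τ => τ.var 6 = i * σ.var 0 + 1) (by simp [Env.set_var]) (fun i hi τ hF hx hI => by
      have e0 := hF.var 0 (by decide)
      norm_num [Env.set_var] at e0
      simp only [Cmd.run, Ex.eval, Env.set_var, hI, e0, if_true]; ring)
    (fun i τ v h => by simpa [Env.set_var] using h)
  norm_num [Env.set_var] at this
  have F := (Cmd.rep 38 5 (.set 6 (.add (.var 6) (.var 0)))).frame (n * n) inp
    ((σ.set 5 (σ.var 4 + 1)).set 6 1)
  have e5 := F.var 5 (by decide)
  norm_num [Env.set_var] at e5
  exact ⟨e5, this⟩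

theorem run_powerCmd {σ : Env} (h7 : σ.var 7 = 1) :
    (powerCmd.run (n * n) inp σ).var 7 = σ.var 6 ^ σ.var 3 := by
  refine Cmd.for_rule (B := n * n) (inp := inp) (x := 38) (y := 3)
    (c := .seq (.set 39 (.lit 0)) <|
      .seq (.rep 40 6 (.set 39 (.add (.var 39) (.var 7)))) (.set 7 (.var 39))) (σ := σ)
    (fun i τ => τ.var 7 = σ.var 6 ^ i) (by simp [h7]) (fun i hi τ hF hx hI => ?_)
    (fun i τ v h => by simpa [Env.set_var] using h)
  have e6 := hF.var 6 (by decide)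
  have := Cmd.for_rule (B := n * n) (inp := inp) (x := 40) (y := 6)
    (c := .set 39 (.add (.var 39) (.var 7))) (σ := τ.set 39 0)
    (fun j υ => υ.var 39 = j * τ.var 7) (by simp [Env.set_var]) (fun j hj υ hF hx hI => by
      have e7 := hF.var 7 (by decide)
      norm_num [Env.set_var] at e7
      simp only [Cmd.run, Ex.eval, Env.set_var, hI, e7, if_true]; ring)
    (fun i τ v h => by simpa [Env.set_var] using h)
  have e6' : (τ.set 39 0).var 6 = σ.var 6 := by rw [← e6]; simp [Env.set_var]
  rw [e6', hI] at this
  simp only [Cmd.run, Ex.eval, Env.set_var, if_true] at this ⊢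
  rw [this, pow_succ, mul_comm]

/-- Only row `0` needs clearing; rows left over from earlier rounds are overwritten before they are
read. -/
theorem run_resetCmd {σ : Env} (hT : Tables n inp σ) (hn : 0 < n) :
    Scanning n inp (resetCmd.run (n * n) inp σ) 0 (resetCmd.run (n * n) inp σ) := by
  have hz := fun v => fill_rule (B := n * n) (inp := inp) (σ := σ) (x := 27) (y := 0)
    (c := .put 5 (.var 27) (.lit 0)) 5 0 (fun _ => 0) (fun i hi τ hF hx hj j => by
      simp [Cmd.run, Ex.eval, Env.put_arr, hx]) v
  rw [hT.size] at hz
  refine ⟨⟨0, 0, 0, ?_⟩, ?_, by simp, ?_, rfl, rfl, by simp⟩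
  · simp [Counters, resetCmd, Cmd.run, Ex.eval, Env.set_var, code, hn]
  · ext v
    have : ((resetCmd.run (n * n) inp σ).arr 5) v = 0 := by
      have := hz v
      simp only [resetCmd, Cmd.run, Env.set_arr] at this ⊢
      rw [this]; simp
    simp [rowSet, mem_toSet, this]
  · simp [resetCmd, Cmd.run, Ex.eval, Env.set_var]

/-- The solutions found so far are `l`. -/
structure RoundInv (n : ℕ) (inp : ℕ → ℕ) (l : List (Finset (Fin n))) (σ : Env) : Prop where
  tables : Tables n inp σ
  depth : n * n ≤ 2 ^ σ.var 3
  len : l.length = σ.var 4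
  next : σ.var 37 = σ.var 4 * n
  rows : ∀ h (hh : h < l.length), rowSet n (σ.arr 4) h = l[h]
  nodup : l.Nodup
  min : ∀ C ∈ l, Minimal (fun Z : Finset (Fin n) => defi inp Z = 1) C
  out : σ.out = l.flatMap encodeSet

theorem run_prepareCmd {σ : Env} {l : List (Finset (Fin n))} (hI : RoundInv n inp l σ) (hn : 0 < n) :
    RoundInv n inp l (prepareCmd.run (n * n) inp σ) ∧
    (prepareCmd.run (n * n) inp σ).var 7 = ((σ.var 4 + 1) * n + 1) ^ σ.var 3 ∧
    Scanning n inp (prepareCmd.run (n * n) inp σ) 0 (prepareCmd.run (n * n) inp σ) := by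
  have F := prepareCmd.frame (n * n) inp σ
  refine ⟨⟨hI.tables.frame F (by decide), ?_, ?_, ?_, ?_, hI.nodup, hI.min, ?_⟩, ?_⟩
  · rw [F.var 3 (by decide)]; exact hI.depth
  · rw [F.var 4 (by decide)]; exact hI.len
  · rw [F.var 37 (by decide), F.var 4 (by decide)]; exact hI.next
  · rw [F.arr 4 (by decide)]; exact hI.rows
  · rw [F.out (by decide)]; exact hI.out
  obtain ⟨σ1, h1⟩ : ∃ τ, countCmd.run (n * n) inp σ = τ := ⟨_, rfl⟩
  have F1 : Frame countCmd σ σ1 := h1 ▸ countCmd.frame _ _ _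
  have e6 := (run_countCmd (n := n) (inp := inp) (σ := σ)).2
  rw [h1, hI.tables.size] at e6
  obtain ⟨σ2, h2⟩ : ∃ τ, powerCmd.run (n * n) inp (σ1.set 7 1) = τ := ⟨_, rfl⟩
  have F2 : Frame powerCmd (σ1.set 7 1) σ2 := h2 ▸ powerCmd.frame _ _ _
  have e7 := run_powerCmd (n := n) (inp := inp) (σ := σ1.set 7 1) (by simp [Env.set_var])
  norm_num [h2, Env.set_var, e6, F1.var 3 (by decide)] at e7
  have T2 : Tables n inp σ2 :=
    ((hI.tables.frame F1 (by decide)).set (by norm_num) _).frame F2 (by decide)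
  have hrun : prepareCmd.run (n * n) inp σ = resetCmd.run (n * n) inp σ2 := by
    simp only [prepareCmd, Cmd.run, Ex.eval, h1, h2]
  rw [hrun]
  exact ⟨by rw [(resetCmd.frame (n * n) inp σ2).var 7 (by decide), e7], run_resetCmd T2 hn⟩

/-- A missing solution would give a good union of at most `σ.var 3` pieces, and all such unions
occur among the scanned rows; hence an unsuccessful scan proves the list complete. -/
theorem run_roundCmd {σ : Env} {l : List (Finset (Fin n))} (hI : RoundInv n inp l σ)
    (hD : (darts n inp).Nonempty) (hn : 0 < n) :
    ((roundCmd.run (n * n) inp σ).var 8 = 0 ∧ RoundInv n inp l (roundCmd.run (n * n) inp σ) ∧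
      ∀ C, Minimal (fun Z : Finset (Fin n) => defi inp Z = 1) C → C ∈ l) ∨
    ((roundCmd.run (n * n) inp σ).var 8 = 1 ∧
      ∃ C, RoundInv n inp (l ++ [C]) (roundCmd.run (n * n) inp σ)) := by
  obtain ⟨I1, e7, S1⟩ := run_prepareCmd hI hn
  have F0 := prepareCmd.frame (n * n) inp σ
  have e4 := F0.var 4 (by decide)
  have e3 := F0.var 3 (by decide)
  obtain ⟨σ1, h1⟩ : ∃ τ, prepareCmd.run (n * n) inp σ = τ := ⟨_, rfl⟩
  rw [h1] at I1 e7 S1 e4 e3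
  rw [← e4, ← e3] at e7
  have hs := run_scanCmd I1.tables hD I1.next S1
  obtain ⟨σ2, h2⟩ : ∃ τ, scanCmd.run (n * n) inp σ1 = τ := ⟨_, rfl⟩
  have F2 : Frame scanCmd σ1 σ2 := h2 ▸ scanCmd.frame _ _ _
  rw [h2] at hs
  have T2 : Tables n inp σ2 := I1.tables.frame F2 (by decide)
  have v3 := F2.var 3 (by decide)
  have v4 := F2.var 4 (by decide)
  have v37 := F2.var 37 (by decide)
  have hrun : roundCmd.run (n * n) inp σ = finishCmd.run (n * n) inp σ2 := by
    simp only [roundCmd, Cmd.run, h1, h2]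
  rw [hrun]
  rcases hs with hs | ⟨f8, C, m1, m2, m3, m4, m5⟩
  · left
    have : finishCmd.run (n * n) inp σ2 = σ2 := by
      simp [finishCmd, Cmd.run, Ex.eval, hs.flag]
    rw [this]
    refine ⟨hs.flag, ⟨T2, ?_, ?_, ?_, ?_, hI.nodup, hI.min, hs.out.trans I1.out⟩, fun C hC => ?_⟩
    · rw [v3]; exact I1.depth
    · rw [v4]; exact I1.len
    · rw [v37, v4]; exact I1.next
    · rw [hs.same]; exact I1.rows
    · by_contra hCl
      -- Two minimal sets of deficiency one that are comparable are equal.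
      have hno : ∀ H ∈ l, ¬ H ⊆ C := fun H hH hs => by
        have := hC.le_of_le (hI.min H hH).prop hs
        exact hCl (Finset.Subset.antisymm hs this ▸ hH)
      obtain ⟨d, hd, Z, hZ, g1, g2⟩ := exists_candidate hD (fun H hH => (hI.min H hH).prop) hno
        hC.prop I1.depth
      rw [e7] at hs
      obtain ⟨k, hk, rfl⟩ := hs.exists_row I1.len I1.rows hZ hd
      have hk' : k < ((σ1.var 4 + 1) * n + 1) ^ σ1.var 3 :=
        lt_of_lt_of_le (Nat.lt_of_succ_le hk) (Nat.pow_le_pow_right (by omega) hd)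
      refine hs.bad k hk' ⟨g1, fun h hh => ?_⟩
      rw [← I1.len] at hh
      rw [I1.rows h hh]
      exact g2 _ (List.getElem_mem hh)
  · right
    have e : finishCmd.run (n * n) inp σ2 =
        (σ2.set 4 (σ2.var 4 + 1)).set 37 (σ2.var 37 + σ2.var 0) := by
      simp [finishCmd, Cmd.run, Ex.eval, f8, Env.set_var]
    rw [e]
    refine ⟨by simp [Env.set_var, f8], C,
      (T2.set (by norm_num) _).set (by norm_num) _, ?_, ?_, ?_, ?_, ?_, ?_, ?_⟩
    · simp [Env.set_var, v3]; exact I1.depth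
    · simp [Env.set_var, v4]; exact I1.len
    · simp [Env.set_var, v4, v37, I1.next, T2.size]; ring
    · intro h hh
      rw [Env.set_arr, Env.set_arr]
      simp only [List.length_append, List.length_singleton] at hh
      by_cases hl : h < l.length
      · rw [List.getElem_append_left hl, m5 h (I1.len ▸ hl), I1.rows h hl]
      · obtain rfl : h = l.length := by omega
        have : rowSet n (σ2.arr 4) l.length = C := by rw [I1.len]; exact m4
        simp [this]
    · rw [List.nodup_append]
      refine ⟨hI.nodup, by simp, ?_⟩
      rintro a ha b hb rfl
      obtain rfl : a = C := by simpa using hb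
      obtain ⟨h, hh, e⟩ := List.mem_iff_getElem.1 ha
      exact m2 h (I1.len ▸ hh) (by rw [I1.rows h hh, e])
    · intro A hA
      rcases List.mem_append.1 hA with hA | hA
      · exact hI.min A hA
      · obtain rfl : A = C := by simpa using hA
        exact m1
    · rw [Env.set_out, Env.set_out, m3, I1.out]
      simp

end

end Merge

/-! ### Preparation and the main loop -/

namespace Merge
open Macro RAM

/-- Compute the table of row offsets and the size of the matrix. -/
def tableCmd : Cmd :=
  .seq (.set 1 (.lit 0)) <| .rep 10 0 (.seq (.put 0 (.var 10) (.var 1)) (.set 1 (.add (.var 1) (.var 0))))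

/-- Count the darts. -/
def dartCmd : Cmd :=
  .seq (.set 2 (.lit 0)) <| .rep 10 1 (.ite (.inp (.var 10)) (.set 2 (.add (.var 2) (.lit 1))) .skip)

/-- Compute the search depth. -/
def depthCmd : Cmd :=
  .seq (.set 9 (.lit 1)) <| .seq (.set 3 (.lit 0)) <|
  .rep 10 1 (.ite (.sub (.var 1) (.var 9))
    (.seq (.set 9 (.add (.var 9) (.var 9))) (.set 3 (.add (.var 3) (.lit 1)))) .skip)

/-- Output all singletons. -/
def singlesCmd : Cmd := .rep 27 0 (.seq (.wr (.add (.var 27) (.lit 1))) (.wr (.lit 0)))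

/-- Everything before the main loop. -/
def startCmd : Cmd :=
  .seq tableCmd <| .seq dartCmd <| .seq depthCmd <| .ite (.var 2) (.set 8 (.lit 1)) singlesCmd

section

variable {n : ℕ} {inp : ℕ → ℕ}

theorem run_tableCmd {σ : Env} (h0 : σ.var 0 = n) :
    (tableCmd.run (n * n) inp σ).var 1 = n * n ∧
      ∀ i < n, (tableCmd.run (n * n) inp σ).arr 0 i = i * n := by
  have := Cmd.for_rule (B := n * n) (inp := inp) (x := 10) (y := 0)
    (c := .seq (.put 0 (.var 10) (.var 1)) (.set 1 (.add (.var 1) (.var 0)))) (σ := σ.set 1 0)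
    (fun i τ => τ.var 1 = i * n ∧ ∀ j < i, τ.arr 0 j = j * n)
    (by simp [Env.set_var]) (fun i hi τ hF hx hI => by
      have e0 := hF.var 0 (by decide)
      norm_num [Env.set_var, h0] at e0
      simp only [Cmd.run, Ex.eval, Env.set_var, Env.put_var, Env.set_arr, Env.put_arr, hx, hI.1, e0,
        true_and, if_true]
      refine ⟨by ring, fun j hj => ?_⟩
      split_ifs with h
      · rw [h]
      · exact hI.2 j (by omega))
    (fun i τ v h => by simpa [Env.set_var] using h)
  norm_num [Env.set_var, h0] at this
  exact this

theorem run_dartCmd {σ : Env} (h1 : σ.var 1 = n * n) :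
    (dartCmd.run (n * n) inp σ).var 2 = (darts n inp).card := by
  have := Cmd.for_rule (B := n * n) (inp := inp) (x := 10) (y := 1)
    (c := .ite (.inp (.var 10)) (.set 2 (.add (.var 2) (.lit 1))) .skip) (σ := σ.set 2 0)
    (fun i τ => τ.var 2 = ((Finset.range i).filter fun a => inp a ≠ 0).card)
    (by simp [Env.set_var]) (fun i hi τ hF hx hI => by
      norm_num [Env.set_var, h1] at hi
      rw [Finset.range_add_one, Finset.filter_insert]
      simp only [Cmd.run, Ex.eval, hx, hi, if_true]
      split_ifs with h
      · rw [Finset.card_insert_of_notMem (by simp), Env.set_var, if_pos rfl, hI]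
      · exact hI) (fun i τ v h => by simpa [Env.set_var] using h)
  norm_num [Env.set_var, h1] at this
  change (Cmd.run (n * n) inp _ (σ.set 2 0)).var 2 = _
  rw [this]
  simp [darts]

/-- The second part, that the exponent is not too large, is what makes the final exponent
logarithmic in `n`. -/
theorem run_depthCmd {σ : Env} :
    σ.var 1 ≤ 2 ^ (depthCmd.run (n * n) inp σ).var 3 ∧
    ((depthCmd.run (n * n) inp σ).var 3 = 0 ∨
      2 ^ ((depthCmd.run (n * n) inp σ).var 3 - 1) < σ.var 1) := by
  have := Cmd.for_rule (B := n * n) (inp := inp) (x := 10) (y := 1)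
    (c := .ite (.sub (.var 1) (.var 9))
      (.seq (.set 9 (.add (.var 9) (.var 9))) (.set 3 (.add (.var 3) (.lit 1)))) .skip)
    (σ := (σ.set 9 1).set 3 0)
    (fun i τ => τ.var 9 = 2 ^ τ.var 3 ∧ (τ.var 3 = i ∨ σ.var 1 ≤ 2 ^ τ.var 3) ∧
      (τ.var 3 = 0 ∨ 2 ^ (τ.var 3 - 1) < σ.var 1))
    (by simp [Env.set_var]) (fun i hi τ hF hx hI => by
      have e1 := hF.var 1 (by decide)
      norm_num [Env.set_var] at e1
      obtain ⟨i1, i2, i3⟩ := hI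
      simp only [Cmd.run, Ex.eval, e1]
      by_cases h : σ.var 1 ≤ 2 ^ τ.var 3
      · rw [if_neg (by omega)]
        exact ⟨i1, .inr h, i3⟩
      · rw [if_pos (by omega)]
        norm_num [Env.set_var, i1, pow_succ]
        refine ⟨by ring, ?_, by omega⟩
        left; exact i2.resolve_right h) (fun i τ v h => by simpa [Env.set_var] using h)
  norm_num [Env.set_var] at this
  obtain ⟨-, a, b⟩ := this
  refine ⟨a.elim (fun h => ?_) id, b⟩
  change σ.var 1 ≤ 2 ^ (Cmd.run (n * n) inp _ ((σ.set 9 1).set 3 0)).var 3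
  rw [h]
  -- If every round doubled, the exponent equals the number of rounds, and `m ≤ 2 ^ m`.
  exact Nat.lt_two_pow_self.le

theorem encodeSet_singleton (v : Fin n) : encodeSet {v} = [(v : ℕ) + 1, 0] := by
  have lift : ∀ l : List (Fin n), (l >>= fun a => pure (a : ℕ)) = l.map Fin.val :=
    fun l => List.flatMap_pure_eq_map _ _
  have : (List.finRange n).filter (fun w => w ∈ ({v} : Finset (Fin n))) = [v] := by
    refine List.perm_singleton.1 ((List.perm_ext_iff_of_nodup
      ((List.nodup_finRange n).filter _) (List.nodup_singleton v)).2 fun w => ?_)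
    simp
  rw [encodeSet, lift, this]
  rfl

theorem run_singlesCmd {σ : Env} (h0 : σ.var 0 = n) :
    (singlesCmd.run (n * n) inp σ).out =
      σ.out ++ ((List.finRange n).map fun v => ({v} : Finset (Fin n))).flatMap encodeSet := by
  have := Cmd.for_rule (B := n * n) (inp := inp) (x := 27) (y := 0)
    (c := .seq (.wr (.add (.var 27) (.lit 1))) (.wr (.lit 0))) (σ := σ)
    (fun i τ => τ.out = σ.out ++ (List.range i).flatMap fun v => [v + 1, 0])
    (by simp) (fun i hi τ hF hx hI => by
      rw [List.range_succ, List.flatMap_append]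
      simp [Cmd.run, Ex.eval, hx, hI]) (fun i τ v h => h)
  rw [h0] at this
  rw [singlesCmd, this, ← List.map_coe_finRange_eq_range, List.flatMap_map, List.flatMap_map]
  simp only [encodeSet_singleton]

/-- The initial configuration of the command language. -/
def initEnv (n : ℕ) : Env where
  var := Function.update (fun _ => 0) 0 n
  arr := fun _ _ => 0
  out := []

theorem run_startCmd (n : ℕ) (inp : ℕ → ℕ) :
    let τ := startCmd.run (n * n) inp (initEnv n)
    (τ.var 3 = 0 ∨ 2 ^ (τ.var 3 - 1) < n * n) ∧
    (((darts n inp).Nonempty ∧ τ.var 8 = 1 ∧ RoundInv n inp [] τ) ∨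
     (¬ (darts n inp).Nonempty ∧ τ.var 8 = 0 ∧
       τ.out = ((List.finRange n).map fun v => ({v} : Finset (Fin n))).flatMap encodeSet)) := by
  obtain ⟨σ1, h1⟩ : ∃ τ, tableCmd.run (n * n) inp (initEnv n) = τ := ⟨_, rfl⟩
  have F1 : Frame tableCmd (initEnv n) σ1 := h1 ▸ tableCmd.frame _ _ _
  obtain ⟨σ2, h2⟩ : ∃ τ, dartCmd.run (n * n) inp σ1 = τ := ⟨_, rfl⟩
  have F2 : Frame dartCmd σ1 σ2 := h2 ▸ dartCmd.frame _ _ _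
  obtain ⟨σ3, h3⟩ : ∃ τ, depthCmd.run (n * n) inp σ2 = τ := ⟨_, rfl⟩
  have F3 : Frame depthCmd σ2 σ3 := h3 ▸ depthCmd.frame _ _ _
  obtain ⟨a1, a2⟩ := run_tableCmd (n := n) (inp := inp) (σ := initEnv n) (by simp [initEnv])
  rw [h1] at a1 a2
  have b1 := run_dartCmd (inp := inp) a1
  rw [h2] at b1
  have c1 := run_depthCmd (n := n) (inp := inp) (σ := σ2)
  rw [h3, F2.var 1 (by decide), a1] at c1
  have T : Tables n inp σ3 := by
    refine ⟨?_, ?_, ?_, ?_⟩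
    · rw [F3.var 0 (by decide), F2.var 0 (by decide), F1.var 0 (by decide)]; simp [initEnv]
    · rw [F3.var 1 (by decide), F2.var 1 (by decide), a1]
    · rw [F3.var 2 (by decide), b1]
    · rw [F3.arr 0 (by decide), F2.arr 0 (by decide)]; exact a2
  have z : ∀ x ∈ [4, 8, 37], σ3.var x = 0 := by
    intro x hx
    have hx' : x = 4 ∨ x = 8 ∨ x = 37 := by simpa using hx
    rcases hx' with rfl | rfl | rfl <;>
    · rw [F3.var _ (by decide), F2.var _ (by decide), F1.var _ (by decide)]; simp [initEnv]
  have o : σ3.out = [] := by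
    rw [F3.out (by decide), F2.out (by decide), F1.out (by decide)]; rfl
  have hrun : startCmd.run (n * n) inp (initEnv n) =
      if (darts n inp).card ≠ 0 then σ3.set 8 1 else singlesCmd.run (n * n) inp σ3 := by
    simp only [startCmd, Cmd.run, h1, h2, h3, Ex.eval, T.card]
  intro τ
  have hτ : τ = _ := hrun
  by_cases hD : (darts n inp).Nonempty
  · rw [if_pos (Finset.card_ne_zero.2 hD)] at hτ
    rw [hτ]
    have e3 : (σ3.set 8 1).var 3 = σ3.var 3 := by simp [Env.set_var]
    refine ⟨e3 ▸ c1.2, .inl ⟨hD, by simp [Env.set_var], T.set (by norm_num) _, e3 ▸ c1.1, ?_, ?_,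
      by simp, by simp, by simp, by simpa using o⟩⟩
    · simp [Env.set_var, z]
    · simp [Env.set_var, z]
  · rw [if_neg (by simpa [Finset.nonempty_iff_ne_empty] using hD)] at hτ
    have F := singlesCmd.frame (n * n) inp σ3
    rw [hτ, F.var 3 (by decide), F.var 8 (by decide), run_singlesCmd T.size, o]
    exact ⟨c1.2, .inr ⟨hD, z 8 (by simp), rfl⟩⟩

/-- Machine code that puts the square of register `0` into register `1`. -/
def squareProg : Prog :=
  .seq (.const 3 0) <| .seq (.add 3 3 0) <| .seq (.const 5 1) <|
  .loop 3 (.seq (.add 1 1 0) (.sub 3 3 5))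

theorem exec_square_loop (m : ℕ) : ∀ s : State, s.reg 3 = m → s.reg 5 = 1 →
    ∃ s', Exec (.loop 3 (.seq (.add 1 1 0) (.sub 3 3 5))) s s' (3 * m + 1) ∧ s'.mem = s.mem ∧
      s'.out = s.out ∧ s'.reg 1 = s.reg 1 + m * s.reg 0 ∧ ∀ x, s'.reg (2 * x) = s.reg (2 * x) := by
  induction m with
  | zero => exact fun s h3 _ => ⟨s, .loop_done h3, rfl, rfl, by simp, fun _ => rfl⟩
  | succ m ih =>
    intro s h3 h5
    let s1 : State := { s with reg := Function.update s.reg 1 (s.reg 1 + s.reg 0) }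
    let s2 : State := { s1 with reg := Function.update s1.reg 3 (s1.reg 3 - s1.reg 5) }
    obtain ⟨s', e, hm, ho, h1, hx⟩ := ih s2 (by simp [s2, s1, h3, h5]) (by simp [s2, s1, h5])
    have ex := Exec.loop_step (x := 3) (by omega) (.seq (.add 1 1 0 s) (.sub 3 3 5 s1)) e
    refine ⟨s', by convert ex using 1; ring, hm, ho, ?_, fun x => ?_⟩
    · rw [h1]; simp [s2, s1]; ring
    · rw [hx]
      have a : 2 * x ≠ 1 := by omega
      have b : 2 * x ≠ 3 := by omega
      simp [s2, s1, a, b]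

/-- The square of `n` is the base address of the arrays, so it must be in place before compiled code
runs. The input is zero from that address on, which gives zeroed arrays. -/
theorem exec_squareProg (G : SimpleGraph (Fin n)) :
    ∃ s, Exec squareProg (graphInput G) s (3 * n + 4) ∧
      Rep (n * n) (graphInput G).mem s (initEnv n) := by
  let s1 : State := { graphInput G with reg := Function.update (graphInput G).reg 3 0 }
  let s2 : State := { s1 with reg := Function.update s1.reg 3 (s1.reg 3 + s1.reg 0) }
  let s3 : State := { s2 with reg := Function.update s2.reg 5 1 }
  obtain ⟨s, e, hm, ho, h1, hx⟩ := exec_square_loop n s3 (by simp [s3, s2, s1, graphInput]) (by simp [s3])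
  have ex := Exec.seq (.const 3 0 (graphInput G)) (.seq (.add 3 3 0 s1) (.seq (.const 5 1 s2) e))
  rw [show 1 + (1 + (1 + (3 * n + 1))) = 3 * n + 4 by ring] at ex
  refine ⟨s, ex, ⟨fun x => ?_, ?_, fun a _ => by rw [hm], fun a i => ?_, ?_⟩⟩
  · have a : 2 * x ≠ 5 := by omega
    have b : 2 * x ≠ 3 := by omega
    rw [hx]
    simp [s3, s2, s1, a, b, graphInput, initEnv, Function.update_apply]
  · rw [h1]; simp [s3, s2, s1, graphInput]
  · rw [hm]
    simp only [s3, s2, s1, graphInput, initEnv, ite_eq_right_iff, one_ne_zero, imp_false]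
    rintro ⟨j, k, -, e⟩
    have := cell_lt j.2 k.2
    omega
  · rw [ho]; rfl

/-- The enumeration program. -/
def enumProg : Prog :=
  .seq squareProg (.seq (startCmd.comp 0) (.loop 16 (roundCmd.comp 0)))

/-- The main loop finds all solutions; `R` bounds the time of a round. -/
theorem exec_main_loop (hD : (darts n inp).Nonempty) (hn : 0 < n) {β R : ℕ}
    (hβ : ∀ l : List (Finset (Fin n)), l.Nodup →
      (∀ C ∈ l, Minimal (fun Z : Finset (Fin n) => defi inp Z = 1) C) → l.length ≤ β)
    {d : ℕ} (hR : ∀ l σ, RoundInv n inp l σ → σ.var 3 = d → roundCmd.time (n * n) inp σ ≤ R) (m : ℕ) :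
    ∀ (l : List (Finset (Fin n))) (s : State) (σ : Env), β ≤ l.length + m → RoundInv n inp l σ →
      σ.var 3 = d → σ.var 8 = 1 → Rep (n * n) inp s σ →
      ∃ s' t, Exec (.loop 16 (roundCmd.comp 0)) s s' t ∧ t ≤ (m + 1) * (R + 1) + 1 ∧
        ∃ l' : List (Finset (Fin n)), l'.Nodup ∧
          (∀ C, C ∈ l' ↔ Minimal (fun Z : Finset (Fin n) => defi inp Z = 1) C) ∧
          s'.out = l'.flatMap encodeSet := by
  induction m with
  | zero =>
    intro l s σ hm hI h3 h8 hs
    obtain ⟨s1, e1, r1, -⟩ := roundCmd.comp_correct (n * n) inp 0 s σ hs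
    have ht := hR l σ hI h3
    have n16 : s.reg 16 ≠ 0 := by rw [hs.var 8, h8]; norm_num
    rcases run_roundCmd hI hD hn with ⟨f, I', hall⟩ | ⟨-, C, I'⟩
    · have z16 : s1.reg 16 = 0 := by rw [r1.var 8, f]
      exact ⟨s1, _, .loop_step n16 e1 (.loop_done z16), by omega, l, hI.nodup,
        fun C => ⟨hI.min C, hall C⟩, by rw [r1.out, I'.out]⟩
    -- The list already has `β` members, so a further solution is impossible.
    · have := hβ _ I'.nodup I'.min
      simp at this
      omega
  | succ m ih =>
    intro l s σ hm hI h3 h8 hs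
    obtain ⟨s1, e1, r1, -⟩ := roundCmd.comp_correct (n * n) inp 0 s σ hs
    have ht := hR l σ hI h3
    have n16 : s.reg 16 ≠ 0 := by rw [hs.var 8, h8]; norm_num
    rcases run_roundCmd hI hD hn with ⟨f, I', hall⟩ | ⟨f, C, I'⟩
    · have z16 : s1.reg 16 = 0 := by rw [r1.var 8, f]
      refine ⟨s1, _, .loop_step n16 e1 (.loop_done z16), ?_, l, hI.nodup,
        fun C => ⟨hI.min C, hall C⟩, by rw [r1.out, I'.out]⟩
      nlinarith
    · obtain ⟨s', t, e, ht', r⟩ := ih (l ++ [C]) s1 _ (by simp; omega) I'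
        (by rw [(roundCmd.frame (n * n) inp σ).var 3 (by decide), h3]) f r1
      refine ⟨s', _, .loop_step n16 e1 e, ?_, r⟩
      rw [show (m + 1 + 1) * (R + 1) = (m + 1) * (R + 1) + (R + 1) by ring]
      omega

end

end Merge

/-! ### Running time -/

namespace Merge
open Macro RAM

section

variable {n : ℕ} {inp : ℕ → ℕ}

theorem time_le_of_bounds {B : ℕ} {M : ℕ} (L : List ℕ) (c : Cmd)
    (hc : (∀ y ∈ c.bounds, y ∈ L) ∧ (∀ y ∈ L, y ∉ c.vars) ∧ c.depth ≤ 10) (σ : Env)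
    (hσ : ∀ y ∈ L, σ.var y ≤ M) : c.time B inp σ ≤ c.size * (M + 1) ^ 10 :=
  (Cmd.time_le M L c hc.1 hc.2.1 σ hσ).trans
    (Nat.mul_le_mul le_rfl (Nat.pow_le_pow_right (by omega) hc.2.2))

theorem time_seq_le {B K : ℕ} {c d : Cmd} {σ : Env} (hc : c.time B inp σ ≤ c.size * K)
    (hd : d.time B inp (c.run B inp σ) ≤ d.size * K) :
    (Cmd.seq c d).time B inp σ ≤ (Cmd.seq c d).size * K := by
  simp only [Cmd.time, Cmd.size, add_mul]; omega

/-- A bound for all loop counts of a round. -/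
def loopBound (n β d : ℕ) : ℕ := ((β + 1) * n + 1) ^ (d + 1)

theorem one_le_base (n β : ℕ) : 1 ≤ (β + 1) * n + 1 := by omega

theorem base_le_loopBound (n β d : ℕ) : (β + 1) * n + 1 ≤ loopBound n β d :=
  Nat.le_self_pow (by omega) _

theorem pow_le_loopBound (n β d : ℕ) : ((β + 1) * n + 1) ^ d ≤ loopBound n β d :=
  Nat.pow_le_pow_right (one_le_base n β) (by omega)

theorem two_pow_le (hn : 0 < n) (β d : ℕ) : 2 ^ d ≤ loopBound n β d := by
  refine (Nat.pow_le_pow_left ?_ d).trans (pow_le_loopBound n β d)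
  have := Nat.mul_le_mul (Nat.le_add_left 1 β) hn
  omega

theorem size_le (n β d : ℕ) : n ≤ loopBound n β d := by
  have := base_le_loopBound n β d
  nlinarith

/-- Preparation computes the loop bounds in variables `5`, `6` and `7`, so its stages are timed
separately, each with bounds that are fixed while it runs. All of them are at most `loopBound n β
d`. -/
theorem time_roundCmd {σ : Env} {l : List (Finset (Fin n))} (hI : RoundInv n inp l σ) (hn : 0 < n)
    {β d : ℕ} (hl : l.length ≤ β) (hd : σ.var 3 = d) :
    roundCmd.time (n * n) inp σ ≤ roundCmd.size * (loopBound n β d + 1) ^ 10 := by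
  set M := loopBound n β d with hM
  have b1 : (β + 1) * n + 1 ≤ M := base_le_loopBound n β d
  have b2 : n * n ≤ M := (hd ▸ hI.depth).trans (two_pow_le hn β d)
  have b3 : n ≤ M := size_le n β d
  have b4 : d ≤ M := Nat.lt_two_pow_self.le.trans (two_pow_le hn β d)
  have b5 : β + 1 ≤ M := by nlinarith
  have hlen := hI.len
  have b6 : (σ.var 4 + 1) * n + 1 ≤ (β + 1) * n + 1 :=
    Nat.add_le_add_right (Nat.mul_le_mul_right _ (by omega)) _
  obtain ⟨I1, e7, -⟩ := run_prepareCmd hI hn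
  obtain ⟨c5, c6⟩ := run_countCmd (n := n) (inp := inp) (σ := σ)
  obtain ⟨σ1, h1⟩ : ∃ τ, countCmd.run (n * n) inp σ = τ := ⟨_, rfl⟩
  have F1 : Frame countCmd σ σ1 := h1 ▸ countCmd.frame _ _ _
  have T1 := hI.tables.frame F1 (by decide)
  rw [h1] at c5 c6
  obtain ⟨σ2, h2⟩ : ∃ τ, powerCmd.run (n * n) inp (σ1.set 7 1) = τ := ⟨_, rfl⟩
  have F2 : Frame powerCmd (σ1.set 7 1) σ2 := h2 ▸ powerCmd.frame _ _ _
  have T2 : Tables n inp σ2 := (T1.set (by norm_num) _).frame F2 (by decide)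
  have tcount : countCmd.time (n * n) inp σ ≤ countCmd.size * (M + 1) ^ 10 := by
    refine time_seq_le (time_le_of_bounds [] _ (by decide) _ (by simp)) (time_seq_le
      (time_le_of_bounds [] _ (by decide) _ (by simp)) (time_le_of_bounds [5] _ (by decide) _ ?_))
    simp [Cmd.run, Ex.eval, Env.set_var]
    omega
  have tpower : powerCmd.time (n * n) inp (σ1.set 7 1) ≤ powerCmd.size * (M + 1) ^ 10 := by
    refine time_le_of_bounds [3, 6] _ (by decide) _ ?_
    have e3 := F1.var 3 (by decide)
    simp [Env.set_var, e3, c6, hd, hI.tables.size]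
    omega
  have treset : resetCmd.time (n * n) inp σ2 ≤ resetCmd.size * (M + 1) ^ 10 :=
    time_le_of_bounds [0] _ (by decide) _ (by simpa [T2.size] using b3)
  have tprepare : prepareCmd.time (n * n) inp σ ≤ prepareCmd.size * (M + 1) ^ 10 := by
    refine time_seq_le tcount (time_seq_le (time_le_of_bounds [] _ (by decide) _ (by simp))
      (time_seq_le ?_ ?_))
    · rw [h1]; exact tpower
    · rw [h1]
      change resetCmd.time (n * n) inp (powerCmd.run (n * n) inp (σ1.set 7 1)) ≤ _
      rw [h2]; exact treset
  refine time_seq_le tprepare (time_seq_le (time_le_of_bounds [0, 1, 4, 7] _ (by decide) _ ?_)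
    (time_le_of_bounds [] _ (by decide) _ (by simp)))
  have e4 := (prepareCmd.frame (n * n) inp σ).var 4 (by decide)
  have b7 : ((σ.var 4 + 1) * n + 1) ^ d ≤ M :=
    (Nat.pow_le_pow_left b6 d).trans (pow_le_loopBound n β d)
  simp [I1.tables.size, I1.tables.sq, e4, e7, hd]
  exact ⟨b3, b2, by omega, b7⟩

theorem time_startCmd (hn : 0 < n) (β : ℕ) :
    startCmd.time (n * n) inp (initEnv n) ≤ startCmd.size *
      (loopBound n β ((startCmd.run (n * n) inp (initEnv n)).var 3) + 1) ^ 10 := by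
  obtain ⟨σ1, h1⟩ : ∃ τ, tableCmd.run (n * n) inp (initEnv n) = τ := ⟨_, rfl⟩
  have F1 : Frame tableCmd (initEnv n) σ1 := h1 ▸ tableCmd.frame _ _ _
  obtain ⟨σ2, h2⟩ : ∃ τ, dartCmd.run (n * n) inp σ1 = τ := ⟨_, rfl⟩
  have F2 : Frame dartCmd σ1 σ2 := h2 ▸ dartCmd.frame _ _ _
  obtain ⟨σ3, h3⟩ : ∃ τ, depthCmd.run (n * n) inp σ2 = τ := ⟨_, rfl⟩
  have F3 : Frame depthCmd σ2 σ3 := h3 ▸ depthCmd.frame _ _ _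
  have a0 : (initEnv n).var 0 = n := by simp [initEnv]
  obtain ⟨a1, a2⟩ := run_tableCmd (n := n) (inp := inp) a0
  rw [h1] at a1
  have c1 := (run_depthCmd (n := n) (inp := inp) (σ := σ2)).1
  rw [h3, F2.var 1 (by decide), a1] at c1
  have e0 : σ3.var 0 = n := by
    rw [F3.var 0 (by decide), F2.var 0 (by decide), F1.var 0 (by decide), a0]
  have e3 : (startCmd.run (n * n) inp (initEnv n)).var 3 = σ3.var 3 := by
    simp only [startCmd, Cmd.run, h1, h2, h3]
    split_ifs
    · simp [Env.set_var]
    · rw [(singlesCmd.frame (n * n) inp σ3).var 3 (by decide)]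
  rw [e3]
  set M := loopBound n β (σ3.var 3) with hM
  have b2 : n * n ≤ M := c1.trans (two_pow_le hn β _)
  have b3 : n ≤ M := size_le n β _
  refine time_seq_le (time_le_of_bounds [0] _ (by decide) _ (by simpa [a0] using b3)) ?_
  rw [h1]
  refine time_seq_le (time_le_of_bounds [1] _ (by decide) _ (by simpa [a1] using b2)) ?_
  rw [h2]
  refine time_seq_le (time_le_of_bounds [1] _ (by decide) _ ?_) ?_
  · simpa [F2.var 1 (by decide), a1] using b2
  rw [h3]
  exact time_le_of_bounds [0] _ (by decide) _ (by simpa [e0] using b3)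

end

/-- A constant for the running time of the program. -/
def timeConst : ℕ := startCmd.size + roundCmd.size + 10

/-- With an edge present there are at most `β + 1` rounds, the last one unsuccessful. This factor
raises the exponent from `10` to `11`. -/
theorem enumerates_enumProg {n : ℕ} (G : SimpleGraph (Fin n)) :
    ∃ t d : ℕ, Enumerates enumProg (graphInput G) (minimalConnectedVertexCovers G) t ∧
      (0 < n → (d = 0 ∨ 2 ^ (d - 1) < n * n) ∧ t ≤ timeConst *
        (loopBound n (minimalConnectedVertexCovers G).ncard d + 1) ^ 11) := by
  set β := (minimalConnectedVertexCovers G).ncard with hβ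
  obtain ⟨s1, e1, r1⟩ := exec_squareProg G
  obtain ⟨s2, e2, r2, -⟩ := startCmd.comp_correct _ _ 0 s1 _ r1
  obtain ⟨hd, hcase⟩ := run_startCmd n (graphInput G).mem
  have hstart := fun hn => time_startCmd (n := n) (inp := (graphInput G).mem) hn β
  obtain ⟨σ, hσ⟩ : ∃ τ, startCmd.run (n * n) (graphInput G).mem (initEnv n) = τ := ⟨_, rfl⟩
  rw [hσ] at r2 hd hcase hstart
  set d := σ.var 3 with hd3
  set M := loopBound n β d with hM
  have b1 : (β + 1) * n + 1 ≤ M := base_le_loopBound n β d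
  have hpow : (M + 1) ^ 11 = (M + 1) ^ 10 * (M + 1) := pow_succ _ _
  have hp1 : M + 1 ≤ (M + 1) ^ 10 := Nat.le_self_pow (by norm_num) _
  have hnM : n ≤ M := size_le n β d
  rcases hcase with ⟨hD, h8, hI⟩ | ⟨hD, h8, ho⟩
  · have hn : 0 < n := by
      obtain ⟨c, hc⟩ := hD
      have hr := Finset.mem_range.1 (Finset.mem_filter.1 hc).1
      exact Nat.pos_of_ne_zero fun h => by simp [h] at hr
    have hfin : (minimalConnectedVertexCovers G).Finite := Set.toFinite _
    have hlen : ∀ l : List (Finset (Fin n)), l.Nodup → (∀ C ∈ l,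
        Minimal (fun Z : Finset (Fin n) => defi (graphInput G).mem Z = 1) C) → l.length ≤ β := by
      intro l hl hm
      rw [← List.toFinset_card_of_nodup hl, ← Set.ncard_coe_finset]
      exact Set.ncard_le_ncard (fun C hC => (minimal_cover_iff G hD C).2 (hm C (by simpa using hC))) hfin
    obtain ⟨s3, t, e3, ht, l, hl, hm, ho⟩ := exec_main_loop hD hn hlen
      (R := roundCmd.size * (M + 1) ^ 10) (d := d)
      (fun l τ hI h3 => time_roundCmd hI hn (hlen l hI.nodup hI.min) h3) β [] s2 σ (by simp) hI rfl h8 r2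
    refine ⟨_, d, ⟨s3, l, .seq e1 (.seq e2 e3), hl,
      fun C => (hm C).trans (minimal_cover_iff G hD C).symm, ho⟩, fun hn => ⟨hd, ?_⟩⟩
    have hs := hstart hn
    have b5 : β + 1 ≤ M := by nlinarith
    have hR : (β + 1) * (roundCmd.size * (M + 1) ^ 10 + 1) ≤
        M * (roundCmd.size * (M + 1) ^ 10 + 1) := Nat.mul_le_mul_right _ b5
    rw [hpow, timeConst]
    generalize (M + 1) ^ 10 = Q at *
    generalize roundCmd.size = a at *
    generalize startCmd.size = b at *
    have q1 : b * Q ≤ b * Q * (M + 1) := Nat.le_mul_of_pos_right _ (by omega)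
    have q2 : 3 * n + 4 + 1 + M ≤ 10 * (Q * (M + 1)) := by nlinarith
    calc _ ≤ 3 * n + 4 + (b * Q + (M * (a * Q + 1) + 1)) := by omega
      _ ≤ b * Q * (M + 1) + M * (a * Q) + 10 * (Q * (M + 1)) := by rw [mul_add]; omega
      _ ≤ (b + a + 10) * (Q * (M + 1)) := by nlinarith [Nat.zero_le (a * Q)]
  · have z16 : s2.reg 16 = 0 := by rw [r2.var 8, h8]
    refine ⟨_, d, ⟨s2, (List.finRange n).map fun v => ({v} : Finset (Fin n)),
      .seq e1 (.seq e2 (.loop_done z16)), ?_, fun C => ?_, by rw [r2.out, ho]⟩, fun hn => ⟨hd, ?_⟩⟩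
    · exact (List.nodup_finRange n).map fun a b h => by simpa using h
    · rw [minimal_cover_iff_of_empty G hD C]
      simp [eq_comm]
    · have hs := hstart hn
      rw [hpow, timeConst]
      generalize (M + 1) ^ 10 = Q at *
      generalize roundCmd.size = a at *
      generalize startCmd.size = b at *
      have q1 : b * Q ≤ b * Q * (M + 1) := Nat.le_mul_of_pos_right _ (by omega)
      have q2 : 3 * n + 4 + 1 ≤ 10 * (Q * (M + 1)) := by nlinarith
      nlinarith [Nat.zero_le (a * (Q * (M + 1)))]

theorem time_le_rpow {n β d t K : ℕ} (hn : 2 ≤ n) (hd : d = 0 ∨ 2 ^ (d - 1) < n * n)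
    (ht : t ≤ K * (loopBound n β d + 1) ^ 11) :
    (t : ℝ) ≤ ((n : ℝ) + (β : ℝ)) ^ (((K + 143 : ℕ) : ℝ) / Real.log 2 * Real.log n) := by
  have hN : 2 ≤ n + β := by omega
  -- The product is at most the square of `n + β`, and a further factor of at least `2` absorbs the
  -- added one.
  have h1 : (β + 1) * n + 1 ≤ (n + β) ^ 3 := by
    have : (β + 1) * n ≤ (n + β) * (n + β) := Nat.mul_le_mul (by omega) (by omega)
    have h2 : 2 * ((n + β) * (n + β)) ≤ (n + β) * ((n + β) * (n + β)) := Nat.mul_le_mul_right _ hN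
    have h3 : 2 * 2 ≤ (n + β) * (n + β) := Nat.mul_le_mul hN hN
    calc _ ≤ (n + β) * ((n + β) * (n + β)) := by omega
      _ = _ := by ring
  have h2 : loopBound n β d + 1 ≤ (n + β) ^ (3 * (d + 1) + 1) := by
    have a : loopBound n β d ≤ (n + β) ^ (3 * (d + 1)) := by
      rw [pow_mul]; exact Nat.pow_le_pow_left h1 _
    have b : 1 ≤ (n + β) ^ (3 * (d + 1)) := Nat.one_le_pow _ _ (by omega)
    calc _ ≤ (n + β) ^ (3 * (d + 1)) * 2 := by omega
      _ ≤ _ := by rw [pow_succ]; exact Nat.mul_le_mul_left _ hN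
  -- The constant factor moves into the exponent through `K ≤ 2 ^ K ≤ (n + β) ^ K`.
  have h3 : t ≤ (n + β) ^ (K + (3 * (d + 1) + 1) * 11) := by
    rw [pow_add, pow_mul]
    exact ht.trans (Nat.mul_le_mul (Nat.lt_two_pow_self.le.trans (Nat.pow_le_pow_left hN K))
      (Nat.pow_le_pow_left h2 11))
  have l2 : 0 < Real.log 2 := Real.log_pos (by norm_num)
  have hnR : (2 : ℝ) ≤ n := by exact_mod_cast hn
  have ln : Real.log 2 ≤ Real.log n := Real.log_le_log (by norm_num) hnR
  have hdl : (d : ℝ) * Real.log 2 ≤ 2 * Real.log n + Real.log 2 := by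
    rcases hd with rfl | hd
    · have := l2.le.trans ln
      simp; linarith
    · rcases Nat.eq_zero_or_pos d with rfl | hp
      · have := l2.le.trans ln
        simp; linarith
      · have : ((2 : ℝ) ^ (d - 1)) ≤ (n : ℝ) * n := by exact_mod_cast hd.le
        have := Real.log_le_log (by positivity) this
        rw [Real.log_pow, Real.log_mul (by positivity) (by positivity), Nat.cast_sub hp] at this
        push_cast at this
        linarith
  -- The exponent is `K + 33 d + 44`. With `d log 2 ≤ 2 log n + log 2`, multiplying it by `log 2`
  -- gives at most `(K + 66) log n + 77 log 2`, and `66 + 77 = 143`.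
  have hexp : ((K + (3 * (d + 1) + 1) * 11 : ℕ) : ℝ) ≤ ((K + 143 : ℕ) : ℝ) / Real.log 2 * Real.log n := by
    rw [div_mul_eq_mul_div, le_div_iff₀ l2]
    push_cast
    have : (K : ℝ) * Real.log 2 ≤ K * Real.log n := mul_le_mul_of_nonneg_left ln (by positivity)
    nlinarith
  calc (t : ℝ) ≤ (((n + β) ^ (K + (3 * (d + 1) + 1) * 11) : ℕ) : ℝ) := by exact_mod_cast h3
    _ = ((n : ℝ) + β) ^ ((K + (3 * (d + 1) + 1) * 11 : ℕ) : ℝ) := by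
      rw [Real.rpow_natCast]; push_cast; rfl
    _ ≤ _ := Real.rpow_le_rpow_of_exponent_le (by have : (0 : ℝ) ≤ β := by positivity
                                                  linarith) hexp

end Merge

theorem theorem4p11 :
    ∃ (p : RAM.Prog) (c : ℝ), ∀ (n : ℕ) (G : SimpleGraph (Fin n)),
      ∃ t : ℕ, RAM.Enumerates p (RAM.graphInput G) (minimalConnectedVertexCovers G) t ∧
        (2 ≤ n → (t : ℝ) ≤
          ((n : ℝ) + ((minimalConnectedVertexCovers G).ncard : ℝ)) ^ (c * Real.log (n : ℝ))) := by
  refine ⟨Merge.enumProg, ((Merge.timeConst + 143 : ℕ) : ℝ) / Real.log 2, fun n G => ?_⟩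
  obtain ⟨t, d, he, ht⟩ := Merge.enumerates_enumProg G
  exact ⟨t, he, fun hn => Merge.time_le_rpow hn (ht (by omega)).1 (ht (by omega)).2⟩
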